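/- **Lemma 3.1.** Let $N\ge 1$, let $(l_{ij})_{1\le i,j\le N}$ be a real symmetric matrix with $l_{11}\neq 0$ (for example the linking matrix of a framed $N$-component link), and let $L_m(\vec a_1,\dots,\vec a_N)$ $(m\ge 2)$ and $P_{m,l}(\vec a_1,\dots,\vec a_N)$ $(m,l\ge 0)$ be homogeneous polynomials of degree $m$ with complex coefficients on $su(2)^N\cong(\mathbb R^3)^N$, invariant under the simultaneous adjoint action of $SU(2)$ (the case where the $P$-sum runs over $m+l\ne0$ is $P_{0,0}=0$). Assume that $L_2=\sum_{i,j=1}^N l_{ij}\,\vec a_i\cdot\vec a_j$ and that every $L_m$ has the *tree property*: it is a linear combination of tree monomials with $m$ legs. A tree monomial is obtained from a tree with trivalent vertices and $m$ legs by placing $\epsilon_{\mu\nu\rho}$ at the vertices, $\delta_{\mu\nu}$ at the edges and vectors $\vec a_j$ at the legs, and contracting. Then there exist $SU(2)$-invariant homogeneous polynomials $L^{(2)}_m(\vec a_2,\dots,\vec a_N)$ and $P^{(2)}_{m,l}(\vec a_2,\dots,\vec a_N)$, $m,l\ge0$, of degree $m$, such that every $L^{(2)}_m$ has the tree property (in the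 variables $\vec a_2,\dots,\vec a_N$), $$L^{(2)}_2=\sum_{2\le i,j\le N} l'_{ij}\,\vec a_i\cdot\vec a_j,\qquad l'_{ij}=l_{ij}-\frac{l_{1i}l_{1j}}{l_{11}},$$ and, for all $K>0$ and all $\vec a_2,\dots,\vec a_N\in\mathbb R^3$, $$e^{i\phi}\Big(\frac K2\Big)^{3/2}\int_{[\vec a_1=-\frac1{l_{11}}\sum_{j\ge2}l_{1j}\vec a_j]} d^3\vec a_1\,\frac{\sin(\pi|\vec a_1|)}{\pi|\vec a_1|}\,\exp\Big[\frac{i\pi K}2\sum_{m\ge2}L_m+\sum_{m,l\ge0}P_{m,l}K^{-l}\Big]=\exp\Big[\frac{i\pi K}2\sum_{m\ge2}L^{(2)}_m+\sum_{m,l\ge0}P^{(2)}_{m,l}K^{-l}\Big],$$ where $\phi=-\frac34\pi\frac{K-2}{K}\,\mathrm{sign}(l_{11})$. This equality is one of formal power series, as follows. Replace every $\vec a_j$ by $t\,\vec a_j$ and $K$ by $t^{-2}K$ in both exponents, in $\sin(\pi|\vec a_1|)/(\pi|\vec a_1|)$ and in $e^{i\phi}$, leaving $(K/2)^{3/2}d^3\vec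 a_1$ unchanged, and expand in powers of $t$. On the left each coefficient of the integrand is $e^{\frac{i\pi K}{2}L_2}$ times a polynomial in the $\vec a_j$; put $\vec a_1=-\frac1{l_{11}}\sum_{j\ge2}l_{1j}\vec a_j+\vec b$ and integrate each coefficient over $\vec b\in\mathbb R^3$ as an oscillatory Gaussian integral, $\int f\,d^3\vec b:=\lim_{\varepsilon\to0^+}\int e^{-\varepsilon|\vec b|^2}f(\vec b)\,d^3\vec b$ (all these limits exist). The coefficients of every power of $t$ on the two sides agree. -/

import Mathlib

open Filter Topology MeasureTheory

noncomputable section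

/-! ## Polynomials on `su(2)^ι`

`su(2)` is identified with `ℝ³`; the variable `X (j, μ)` is the `μ`-th coordinate of the
`j`-th vector. -/

/-- Complex polynomials in the coordinates of a family of vectors `a j ∈ su(2) ≅ ℝ³`, `j : ι`. -/
abbrev VecPoly (ι : Type) : Type := MvPolynomial (ι × Fin 3) ℂ

/-- The value of a polynomial at a family of real vectors. -/
def VecPoly.at {ι : Type} (Q : VecPoly ι) (a : ι → Fin 3 → ℝ) : ℂ :=
  MvPolynomial.eval (fun p : ι × Fin 3 => ((a p.1 p.2 : ℝ) : ℂ)) Q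

/-- The `j`-th vector, as a vector of coordinate polynomials. -/
def vecVar {ι : Type} (j : ι) : Fin 3 → VecPoly ι := fun μ => MvPolynomial.X (j, μ)

/-- The traceless Hermitian matrix `v · σ` (`σ` the Pauli matrices). Up to the factor `i / 2` this
is the identification of `ℝ³` with `su(2)` that turns the cross product into the bracket. -/
def pauli (v : Fin 3 → ℝ) : Matrix (Fin 2) (Fin 2) ℂ :=
  !![(v 2 : ℂ), (v 0 : ℂ) - Complex.I * (v 1 : ℂ);
     (v 0 : ℂ) + Complex.I * (v 1 : ℂ), -(v 2 : ℂ)]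

/-- Invariance under the simultaneous adjoint action of `SU(2)` on all vectors. -/
def IsSU2Invariant {ι : Type} (Q : VecPoly ι) : Prop :=
  ∀ U ∈ Matrix.specialUnitaryGroup (Fin 2) ℂ, ∀ a b : ι → Fin 3 → ℝ,
    (∀ j, pauli (b j) = U * pauli (a j) * star U) → Q.at b = Q.at a

/-- `Q` is an `SU(2)`-invariant homogeneous polynomial of order `m`. -/
def IsInvariantForm {ι : Type} (m : ℕ) (Q : VecPoly ι) : Prop :=
  Q.IsHomogeneous m ∧ IsSU2Invariant Q

/-! ## Tree monomials -/

/-- Rooted trees with trivalent vertices: every vertex has one edge towards the root and an ordered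
pair of edges away from it; the legs other than the root carry labels in `ι`. -/
inductive LegTree (ι : Type) : Type
  | leg : ι → LegTree ι
  | vertex : LegTree ι → LegTree ι → LegTree ι

namespace LegTree

/-- The number of labelled legs. -/
def legs {ι : Type} : LegTree ι → ℕ
  | leg _ => 1
  | vertex s t => s.legs + t.legs

/-- The contraction of a rooted tree, a vector with the index of the root edge: the vector `a_j` at
a leg labelled `j`, and at each vertex the structure constants `ε_{μνρ}` of `su(2)`, that is
`(v × w)_μ = ∑ ε_{μνρ} v_ν w_ρ`. -/
def value {ι : Type} : LegTree ι → Fin 3 → VecPoly ι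
  | leg j => vecVar j
  | vertex s t => crossProduct s.value t.value

end LegTree

/-- The tree monomials with `m` legs. An (unrooted) tree with trivalent vertices and `m ≥ 2` legs is
obtained by joining two rooted trees along an edge (any edge of it); that edge carries the scalar
product `δ_{μν}`. The tree without vertices is the single edge with two legs. -/
def treeMonomials (ι : Type) (m : ℕ) : Set (VecPoly ι) :=
  {Q | ∃ s t : LegTree ι, s.legs + t.legs = m ∧ Q = dotProduct s.value t.value}

/-- The tree property: `Q` is a linear combination of tree monomials with `m` legs. -/
def IsTreePolynomial {ι : Type} (m : ℕ) (Q : VecPoly ι) : Prop :=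
  Q ∈ Submodule.span ℂ (treeMonomials ι m)

/-- The quadratic form `∑_{i,j} l_{ij} a_i · a_j`. -/
def linkingForm {ι : Type} [Fintype ι] (l : Matrix ι ι ℝ) : VecPoly ι :=
  ∑ i, ∑ j, MvPolynomial.C ((l i j : ℝ) : ℂ) * dotProduct (vecVar i) (vecVar j)

/-! ## The formal expansion

The perturbative expansion is organised by a formal parameter `t` : every vector `a_j` carries
weight `1` and `K⁻¹` carries weight `2`, that is, `a_j` is replaced by `t a_j` and `K` by `t⁻² K`.
The Gaussian part `exp ((iπK/2) L₂)` and the measure `K^{3/2} d³a` then have weight `0` and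
everything else is a power series in `t`. A monomial of degree `d` in the vectors multiplied by
`K⁻ⁿ` occurs exactly in the coefficient of `t ^ (d + 2 n)`. -/

/-- The exponential of a formal power series with complex coefficients, with an arbitrary
constant coefficient `c`, namely `e^c ∑_k (f - c)^k / k!`. -/
def formalExp (f : PowerSeries ℂ) : PowerSeries ℂ :=
  PowerSeries.C (Complex.exp (PowerSeries.constantCoeff f)) *
    PowerSeries.subst (f - PowerSeries.C (PowerSeries.constantCoeff f)) (PowerSeries.exp ℂ)

/-- The exponent `(iπK/2) ∑_{m ≥ 2} L_m(a) + ∑_{m,l ≥ 0} P_{m,l}(a) K^{-l}`, in powers of `t` :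
`K L_m(a)` has weight `m - 2` and `P_{m,l}(a) K^{-l}` has weight `m + 2 l`. -/
def exponent {ι : Type} (L : ℕ → VecPoly ι) (P : ℕ → ℕ → VecPoly ι) (K : ℝ)
    (a : ι → Fin 3 → ℝ) : PowerSeries ℂ :=
  PowerSeries.mk fun k =>
    Complex.I * (Real.pi : ℂ) * (K : ℂ) / 2 * (L (k + 2)).at a +
      ∑ l ∈ Finset.range (k / 2 + 1), (P (k - 2 * l) l).at a * ((K : ℂ)⁻¹) ^ l

/-- The Taylor expansion `∑_r (-1)^r π^{2r} |v|^{2r} t^{2r} / (2r+1)!` of the factor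
`sin (π|v|) / (π|v|)`, in powers of `t`. -/
def sincFactor (v : Fin 3 → ℝ) : PowerSeries ℂ :=
  PowerSeries.mk fun k =>
    if Even k then
      (((-1) ^ (k / 2) * (Real.pi ^ 2 * dotProduct v v) ^ (k / 2) / ((k + 1).factorial : ℝ) : ℝ) : ℂ)
    else 0

/-- The framing factor `exp (i φ)`, `φ = -(3/4) π ((K - 2) / K) sign x`, in powers of `t` :
`-(3/4) π sign x` has weight `0` and `(3/2) π (sign x) K⁻¹` has weight `2`. -/
def framingFactor (x K : ℝ) : PowerSeries ℂ :=
  formalExp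
    (PowerSeries.C (-(3 / 4) * Complex.I * (Real.pi : ℂ) * (Real.sign x : ℂ)) +
      PowerSeries.C (3 / 2 * Complex.I * (Real.pi : ℂ) * (Real.sign x : ℂ) * (K : ℂ)⁻¹) *
        PowerSeries.X ^ 2)

/-- The integrand `sin (π|a_1|) / (π|a_1|) exp [(iπK/2) ∑ L_m(a) + ∑ P_{m,l}(a) K^{-l}]`,
in powers of `t`; the vector `a_1` is `a 0`. Each coefficient is the Gaussian `exp ((iπK/2) L₂(a))`
times a polynomial in `a`. -/
def integrand {n : ℕ} (L : ℕ → VecPoly (Fin (n + 1))) (P : ℕ → ℕ → VecPoly (Fin (n + 1))) (K : ℝ)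
    (a : Fin (n + 1) → Fin 3 → ℝ) : PowerSeries ℂ :=
  sincFactor (a 0) * formalExp (exponent L P K a)

/-! ## The integral over the first vector -/

/-- `I` is the oscillatory integral `∫ f(b) d³b`, defined with a Gaussian regulator:
`I = lim_{ε → 0+} ∫ exp (-ε |b|²) f(b) d³b`. -/
def HasOscillatoryIntegral (f : (Fin 3 → ℝ) → ℂ) (I : ℂ) : Prop :=
  (∀ ε : ℝ, 0 < ε → Integrable (fun b : Fin 3 → ℝ => (Real.exp (-ε * dotProduct b b) : ℂ) * f b)) ∧
    Tendsto (fun ε : ℝ => ∫ b : Fin 3 → ℝ, (Real.exp (-ε * dotProduct b b) : ℂ) * f b)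
      (𝓝[>] 0) (𝓝 I)

/-- The stationary point `-(1/l₁₁) ∑_{j ≥ 2} l_{1j} a_j` of the Gaussian part. -/
def stationaryPoint {n : ℕ} (l : Matrix (Fin (n + 1)) (Fin (n + 1)) ℝ)
    (a : Fin n → Fin 3 → ℝ) : Fin 3 → ℝ :=
  -(1 / l 0 0) • ∑ j : Fin n, l 0 j.succ • a j

/-- `I` is the contribution of the point `a_1 = c` to the integral of the formal series `F(a_1)`
over `a_1` : one puts `a_1 = c + b` and integrates each coefficient over the fluctuation `b`. -/
def HasFormalIntegralAt (c : Fin 3 → ℝ) (F : (Fin 3 → ℝ) → PowerSeries ℂ) (I : PowerSeries ℂ) :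
    Prop :=
  ∀ k : ℕ, HasOscillatoryIntegral (fun b => PowerSeries.coeff k (F (c + b))) (PowerSeries.coeff k I)

/-- The reduced linking matrix `l'_{ij} = l_{ij} - l_{1i} l_{1j} / l₁₁`, `i, j ≥ 2`. -/
def reducedLinking {n : ℕ} (l : Matrix (Fin (n + 1)) (Fin (n + 1)) ℝ) :
    Matrix (Fin n) (Fin n) ℝ :=
  Matrix.of fun i j => l i.succ j.succ - l 0 i.succ * l 0 j.succ / l 0 0

end

/-!
The integral is a Gaussian expectation of the exponential of a power series in `t`, and Gaussian
expectation is the heat flow: `∫ exp (-z |b|²) f(b) d³b = (π / z) ^ (3/2) (exp (Δ / 4z) f)(0)`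
for polynomials `f`, with `z → -iπK l₁₁ / 2` in the oscillatory limit. The idea is to follow the
logarithm of the integrand along this flow instead of summing connected Feynman diagrams. If
`Z = exp W` solves the heat equation `∂ₛ Z = K⁻¹ Δ Z`, then `W` solves
`∂ₛ W = K⁻¹ (Δ W + ⟨∇ W, ∇ W⟩)`, and for `U = h W`, `h = K⁻¹`, this reads
`∂ₛ U = h Δ U + ⟨∇ U, ∇ U⟩`. Let the coefficients of `U` have the form
(tree polynomial) + `h` (invariant form) + `h²` (invariant form) + ... . This form is preserved:

* `⟨∇ T, ∇ T'⟩` removes one leg from each of two trees and joins the trees at the new ends, so it is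
  a tree polynomial (`isTreePolynomial_gradDot`; the vertices are cross products, and the triple
  product identity moves the root of a tree to the leg that is differentiated);
* every other term carries at least one `h`, and `Δ` and `⟨∇ ·, ∇ ·⟩` commute with rotations, so
  they preserve `SU(2)`-invariance (`isInvariantForm_laplacian`, `isInvariantForm_gradDot`).

The degrees match, since `K L_m` has weight `m - 2` in `t`. The flow is solved as a power series in
`s` (`flow`); each of its coefficients in `t` is a polynomial in `s`, because each contraction
lowers the degree in the vectors while the degree available at order `t ^ k` is at most `3 k`
(`expansionTerms`, `flow_eq_zero`). Hence it can be evaluated at `s = i / (2π l₁₁)` and `a_1 = 0`,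
which gives the new exponent.

Three further facts connect this to the statement. The factor `sin (π|a_1|) / (π|a_1|)` is the
exponential of a series of invariant forms (`exists_integrand_eq_formalExp`). Completing the square
turns `L₂` into the reduced linking form plus `l₁₁ |b|²` (`at_linkingForm_vecCons`). The heat
operator computes the Gaussian integral of a polynomial because both satisfy the Schwinger-Dyson
equations `E (b_μ f) = 2 c E (∂_μ f)`, which determine `E` up to `E 1`
(`eq_heatSum_of_schwingerDyson`, `hasOscillatoryIntegral_gaussian`).
-/

noncomputable section

/-! ### Exponentials of power series -/

namespace PowerSeries

/-- Over a `ℚ`-algebra, a linear differential equation `y' = a y` has at most one solution with a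
given constant coefficient. -/
theorem eq_of_derivative_eq_mul {R : Type*} [CommRing R] [Algebra ℚ R] {a y z : PowerSeries R}
    (hy : d⁄dX R y = a * y) (hz : d⁄dX R z = a * z)
    (h0 : constantCoeff y = constantCoeff z) : y = z := by
  rw [← sub_eq_zero]
  set w := y - z with hw
  have hd : d⁄dX R w = a * w := by rw [hw, map_sub, hy, hz, mul_sub]
  have hw0 : coeff 0 w = 0 := by simp [hw, h0]
  ext n
  induction n using Nat.strong_induction_on with
  | _ n ih =>
    cases n with
    | zero => simpa using hw0
    | succ n =>
      have h := congrArg (coeff n) hd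
      rw [coeff_derivative, coeff_mul] at h
      have hz : ∑ p ∈ Finset.HasAntidiagonal.antidiagonal n, coeff p.1 a * coeff p.2 w = 0 := by
        refine Finset.sum_eq_zero fun p hp => ?_
        have := Finset.HasAntidiagonal.mem_antidiagonal.1 hp
        rw [ih p.2 (by omega)]
        simp
      rw [hz] at h
      have hu : IsUnit ((n : R) + 1) := by
        have : ((n : R) + 1) = algebraMap ℚ R ((n : ℚ) + 1) := by simp
        rw [this]
        exact (IsUnit.mk0 _ (by positivity)).map _
      simpa using (hu.mul_left_eq_zero).1 h

section ExpOf

variable {R : Type*} [CommRing R] [Algebra ℚ R]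

/-- The exponential `∑ fⁿ / n!` of a power series `f` without constant coefficient. -/
def expOf (f : PowerSeries R) : PowerSeries R := (exp R).subst f

theorem constantCoeff_expOf {f : PowerSeries R} (hf : constantCoeff f = 0) :
    constantCoeff (expOf f) = 1 := by
  have h := constantCoeff_subst_eq_zero (a := f) (f := exp R - 1) (by exact hf) (by simp)
  rw [subst_sub (HasSubst.of_constantCoeff_zero' hf)] at h
  have h1 : (1 : PowerSeries R).subst f = (1 : PowerSeries R) := by
    rw [← coe_substAlgHom (HasSubst.of_constantCoeff_zero' hf)]; exact map_one _
  rw [h1, map_sub, sub_eq_zero] at h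
  exact h.trans (map_one _)

theorem derivative_expOf {f : PowerSeries R} (hf : constantCoeff f = 0) :
    d⁄dX R (expOf f) = d⁄dX R f * expOf f := by
  rw [expOf, derivative_subst (HasSubst.of_constantCoeff_zero' hf), derivative_exp, mul_comm]

/-- The exponential is the unique solution `y` of `y' = f' y` with constant coefficient `1`. -/
theorem eq_expOf {f y : PowerSeries R} (hf : constantCoeff f = 0)
    (hy : d⁄dX R y = d⁄dX R f * y) (h0 : constantCoeff y = 1) : y = expOf f :=
  eq_of_derivative_eq_mul hy (derivative_expOf hf) (h0.trans (constantCoeff_expOf hf).symm)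

theorem expOf_add {f g : PowerSeries R} (hf : constantCoeff f = 0) (hg : constantCoeff g = 0) :
    expOf (f + g) = expOf f * expOf g := by
  refine (eq_expOf (by simp [hf, hg]) ?_ ?_).symm
  · rw [Derivation.leibniz, derivative_expOf hf, derivative_expOf hg, map_add]
    simp only [smul_eq_mul]
    ring
  · rw [map_mul, constantCoeff_expOf hf, constantCoeff_expOf hg, one_mul]

theorem derivative_map {R S : Type*} [CommRing R] [CommRing S] (φ : R →+* S) (f : PowerSeries R) :
    d⁄dX S (map φ f) = map φ (d⁄dX R f) := by
  ext n
  simp [coeff_derivative]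

theorem map_expOf {S : Type*} [CommRing S] [Algebra ℚ S] (φ : R →+* S) {f : PowerSeries R}
    (hf : constantCoeff f = 0) : map φ (expOf f) = expOf (map φ f) := by
  refine eq_expOf (by rw [← coeff_zero_eq_constantCoeff_apply] at hf ⊢; simp [hf]) ?_ ?_
  · rw [derivative_map, derivative_map, derivative_expOf hf, map_mul]
  · have h1 := constantCoeff_expOf hf
    rw [← coeff_zero_eq_constantCoeff_apply] at h1 ⊢
    simp [h1]

end ExpOf

/-- The derivation of `R⟦X⟧` that applies a derivation of `R` to every coefficient. -/
def coeffDerivation {R : Type*} [CommRing R] [Algebra ℚ R] (D : Derivation ℚ R R) :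
    Derivation ℚ (PowerSeries R) (PowerSeries R) :=
  Derivation.mk'
    { toFun := fun f => mk fun k => D (coeff k f)
      map_add' := fun f g => by ext; simp
      map_smul' := fun c f => by ext; simp }
    (fun f g => by
      ext n
      simp only [LinearMap.coe_mk, AddHom.coe_mk, coeff_mk, smul_eq_mul, map_add, coeff_mul,
        map_sum, Derivation.leibniz]
      rw [Finset.sum_add_distrib]
      congr 1
      rw [← Finset.Nat.sum_antidiagonal_swap]
      rfl)

@[simp] theorem coeff_coeffDerivation {R : Type*} [CommRing R] [Algebra ℚ R]
    (D : Derivation ℚ R R) (f : PowerSeries R) (k : ℕ) :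
    coeff k (coeffDerivation D f) = D (coeff k f) := by
  simp [coeffDerivation]

theorem coeffDerivation_derivative {R : Type*} [CommRing R] [Algebra ℚ R]
    (D : Derivation ℚ R R) (f : PowerSeries R) :
    coeffDerivation D (d⁄dX R f) = d⁄dX R (coeffDerivation D f) := by
  ext k
  simp [coeff_derivative]
  rw [mul_comm]

theorem coeffDerivation_expOf {R : Type*} [CommRing R] [Algebra ℚ R]
    (D : Derivation ℚ R R) {f : PowerSeries R} (hf : constantCoeff f = 0) :
    coeffDerivation D (expOf f) = coeffDerivation D f * expOf f := by
  rw [← sub_eq_zero]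
  refine eq_of_derivative_eq_mul (a := d⁄dX R f) ?_ (by simp) ?_
  · rw [map_sub, ← coeffDerivation_derivative, derivative_expOf hf, Derivation.leibniz,
      Derivation.leibniz, derivative_expOf hf, coeffDerivation_derivative]
    simp only [smul_eq_mul]
    ring
  · have h1 := constantCoeff_expOf hf
    rw [← coeff_zero_eq_constantCoeff_apply] at h1 hf
    rw [map_sub, map_mul, ← coeff_zero_eq_constantCoeff_apply,
      ← coeff_zero_eq_constantCoeff_apply, coeff_coeffDerivation, coeff_coeffDerivation, h1, hf]
    simp

/-- Every power series over a field of characteristic zero with constant coefficient `1` is an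
exponential. -/
theorem exists_expOf_eq {k : Type*} [Field k] [CharZero k] {g : PowerSeries k}
    (hg : constantCoeff g = 1) : ∃ f : PowerSeries k, constantCoeff f = 0 ∧ expOf f = g := by
  have hf : ∃ f : PowerSeries k, constantCoeff f = 0 ∧ d⁄dX k f = d⁄dX k g * g⁻¹ := by
    refine ⟨mk fun n => if n = 0 then 0 else coeff (n - 1) (d⁄dX k g * g⁻¹) / n, by simp, ?_⟩
    ext n
    have : (n : k) + 1 ≠ 0 := Nat.cast_add_one_ne_zero n
    simp only [coeff_derivative, coeff_mk]
    push_cast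
    simp [this]
  obtain ⟨f, hf0, hf⟩ := hf
  refine ⟨f, hf0, (eq_expOf hf0 ?_ hg).symm⟩
  rw [hf, mul_assoc, PowerSeries.inv_mul_cancel _ (by simp [hg]), mul_one]

end PowerSeries

theorem formalExp_eq (f : PowerSeries ℂ) :
    formalExp f = PowerSeries.C (Complex.exp (PowerSeries.constantCoeff f)) *
      PowerSeries.expOf (f - PowerSeries.C (PowerSeries.constantCoeff f)) := rfl

theorem formalExp_add (f g : PowerSeries ℂ) : formalExp (f + g) = formalExp f * formalExp g := by
  rw [formalExp_eq, formalExp_eq, formalExp_eq, map_add, Complex.exp_add, map_mul, map_add,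
    add_sub_add_comm, PowerSeries.expOf_add (by simp) (by simp)]
  ring

theorem formalExp_of_constantCoeff_eq_zero {f : PowerSeries ℂ}
    (hf : PowerSeries.constantCoeff f = 0) : formalExp f = PowerSeries.expOf f := by
  simp [formalExp_eq, hf]

theorem formalExp_C (c : ℂ) : formalExp (PowerSeries.C c) = PowerSeries.C (Complex.exp c) := by
  have h : PowerSeries.expOf (0 : PowerSeries ℂ) = 1 :=
    (PowerSeries.eq_expOf (by simp) (by simp) (by simp)).symm
  simp [formalExp_eq, h]

/-! ### Rooted trees and the gradient -/

/-- Evaluation at a family of real vectors, as an algebra homomorphism. -/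
def VecPoly.evalAt {ι : Type} (a : ι → Fin 3 → ℝ) : VecPoly ι →ₐ[ℂ] ℂ :=
  MvPolynomial.aeval fun p => ((a p.1 p.2 : ℝ) : ℂ)

theorem VecPoly.evalAt_apply {ι : Type} (a : ι → Fin 3 → ℝ) (Q : VecPoly ι) :
    VecPoly.evalAt a Q = Q.at a := rfl

namespace LegTree

theorem legs_pos {ι : Type} : ∀ s : LegTree ι, 0 < s.legs
  | leg _ => Nat.one_pos
  | vertex s _ => Nat.add_pos_left s.legs_pos _

end LegTree

/-- The linear combinations of the vector-valued contractions of rooted trees with `m` labelled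
legs. -/
def rootedTreeSpan (ι : Type) (m : ℕ) : Submodule ℂ (Fin 3 → VecPoly ι) :=
  Submodule.span ℂ {v | ∃ s : LegTree ι, s.legs = m ∧ v = s.value}

theorem LegTree.value_mem_rootedTreeSpan {ι : Type} (s : LegTree ι) :
    s.value ∈ rootedTreeSpan ι s.legs :=
  Submodule.subset_span ⟨s, rfl, rfl⟩

/-- The cross product of vectors of polynomials, as a `ℂ`-bilinear map. -/
def crossBilin (ι : Type) :
    (Fin 3 → VecPoly ι) →ₗ[ℂ] (Fin 3 → VecPoly ι) →ₗ[ℂ] (Fin 3 → VecPoly ι) :=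
  LinearMap.mk₂ ℂ (fun v w => crossProduct v w) (by simp)
    (fun c v w => by
      ext1 μ; fin_cases μ <;> simp [cross_apply, smul_sub])
    (by simp)
    (fun c v w => by
      ext1 μ; fin_cases μ <;> simp [cross_apply, smul_sub])

/-- The scalar product of vectors of polynomials, as a `ℂ`-bilinear map. -/
def dotBilin (ι : Type) :
    (Fin 3 → VecPoly ι) →ₗ[ℂ] (Fin 3 → VecPoly ι) →ₗ[ℂ] VecPoly ι :=
  LinearMap.mk₂ ℂ (fun v w => dotProduct v w) (by simp [add_dotProduct])
    (by simp) (by simp [dotProduct_add]) (by simp)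

theorem crossProduct_mem_rootedTreeSpan {ι : Type} {m n : ℕ} {v w : Fin 3 → VecPoly ι}
    (hv : v ∈ rootedTreeSpan ι m) (hw : w ∈ rootedTreeSpan ι n) :
    crossProduct v w ∈ rootedTreeSpan ι (m + n) := by
  have h := Submodule.apply_mem_map₂ (crossBilin ι) hv hw
  rw [rootedTreeSpan, rootedTreeSpan, Submodule.map₂_span_span] at h
  refine Submodule.span_mono ?_ h
  rintro _ ⟨_, ⟨s, rfl, rfl⟩, _, ⟨t, rfl, rfl⟩, rfl⟩
  exact ⟨s.vertex t, rfl, rfl⟩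

theorem isTreePolynomial_dotProduct {ι : Type} {m n : ℕ} {v w : Fin 3 → VecPoly ι}
    (hv : v ∈ rootedTreeSpan ι m) (hw : w ∈ rootedTreeSpan ι n) :
    IsTreePolynomial (m + n) (dotProduct v w) := by
  have h := Submodule.apply_mem_map₂ (dotBilin ι) hv hw
  rw [rootedTreeSpan, rootedTreeSpan, Submodule.map₂_span_span] at h
  refine Submodule.span_mono ?_ h
  rintro _ ⟨_, ⟨s, rfl, rfl⟩, _, ⟨t, rfl, rfl⟩, rfl⟩
  exact ⟨s, t, rfl, rfl⟩

section Derivatives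

variable {ι : Type} (i : ι)

/-- The gradient with respect to the vector `a i`. -/
def grad : VecPoly ι →ₗ[ℂ] (Fin 3 → VecPoly ι) :=
  LinearMap.pi fun μ => (MvPolynomial.pderiv (i, μ)).toLinearMap

@[simp] theorem grad_apply (Q : VecPoly ι) (μ : Fin 3) :
    grad i Q μ = MvPolynomial.pderiv (i, μ) Q := rfl

/-- The scalar product of the gradients with respect to `a i`. -/
def gradDot : VecPoly ι →ₗ[ℂ] VecPoly ι →ₗ[ℂ] VecPoly ι :=
  (dotBilin ι).compl₁₂ (grad i) (grad i)

theorem gradDot_apply (Q Q' : VecPoly ι) :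
    gradDot i Q Q' = ∑ μ, MvPolynomial.pderiv (i, μ) Q * MvPolynomial.pderiv (i, μ) Q' := rfl

/-- The Laplacian with respect to the vector `a i`. -/
def laplacian : VecPoly ι →ₗ[ℂ] VecPoly ι :=
  ∑ μ : Fin 3, (MvPolynomial.pderiv (i, μ)).toLinearMap ∘ₗ (MvPolynomial.pderiv (i, μ)).toLinearMap

theorem laplacian_apply (Q : VecPoly ι) :
    laplacian i Q = ∑ μ : Fin 3, MvPolynomial.pderiv (i, μ) (MvPolynomial.pderiv (i, μ) Q) := by
  simp [laplacian]

/-- Differentiating a rooted tree with respect to the vector at its legs and contracting the root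
with `v` moves the root to the leg that was removed, with `v` grafted onto the former root. -/
theorem derivative_value_mem_rootedTreeSpan (s : LegTree ι) :
    ∀ {n : ℕ} {v : Fin 3 → VecPoly ι}, v ∈ rootedTreeSpan ι n →
      (fun μ => ∑ ν, MvPolynomial.pderiv (i, μ) (s.value ν) * v ν) ∈
        rootedTreeSpan ι (s.legs + n - 1) := by
  induction s with
  | leg j =>
    intro n v hv
    have hn : (LegTree.leg j).legs + n - 1 = n := Nat.add_sub_cancel_left 1 n
    rw [hn]
    by_cases hij : j = i
    · subst hij
      convert hv using 1
      ext1 μ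
      simp only [LegTree.value, vecVar]
      rw [Finset.sum_eq_single μ] <;> simp +contextual
    · convert (rootedTreeSpan ι n).zero_mem using 1
      ext1 μ
      simp only [LegTree.value, vecVar]
      refine Finset.sum_eq_zero fun ν _ => ?_
      rw [MvPolynomial.pderiv_X_of_ne (by simp [hij]), zero_mul]
  | vertex s t hs ht =>
    intro n v hv
    have h1 := hs (crossProduct_mem_rootedTreeSpan t.value_mem_rootedTreeSpan hv)
    have h2 := ht (crossProduct_mem_rootedTreeSpan hv s.value_mem_rootedTreeSpan)
    have e1 : s.legs + (t.legs + n) - 1 = (s.vertex t).legs + n - 1 := by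
      simp only [LegTree.legs]; omega
    have e2 : t.legs + (n + s.legs) - 1 = (s.vertex t).legs + n - 1 := by
      simp only [LegTree.legs]; omega
    rw [e1] at h1
    rw [e2] at h2
    convert Submodule.add_mem _ h1 h2 using 1
    ext1 μ
    simp only [LegTree.value, cross_apply, Fin.sum_univ_three, Pi.add_apply, Matrix.cons_val,
      map_sub, MvPolynomial.pderiv_mul]
    ring

theorem grad_mem_rootedTreeSpan {m : ℕ} {Q : VecPoly ι} (hQ : IsTreePolynomial m Q) :
    grad i Q ∈ rootedTreeSpan ι (m - 1) := by
  have h := Submodule.mem_map_of_mem (f := grad i) hQ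
  rw [Submodule.map_span] at h
  refine Submodule.span_le.2 ?_ h
  rintro _ ⟨_, ⟨s, t, rfl, rfl⟩, rfl⟩
  have h1 := derivative_value_mem_rootedTreeSpan i s t.value_mem_rootedTreeSpan
  have h2 := derivative_value_mem_rootedTreeSpan i t s.value_mem_rootedTreeSpan
  rw [add_comm] at h2
  refine (congrArg (· ∈ rootedTreeSpan ι _) ?_).mpr (Submodule.add_mem _ h1 h2)
  ext1 μ
  simp only [grad_apply, dotProduct, map_sum, MvPolynomial.pderiv_mul, Finset.sum_add_distrib,
    Pi.add_apply]
  congr 1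
  exact Finset.sum_congr rfl fun ν _ => mul_comm _ _

/-- Joining two trees along a pair of removed legs gives trees. -/
theorem isTreePolynomial_gradDot {m n : ℕ} {Q Q' : VecPoly ι} (hQ : IsTreePolynomial m Q)
    (hQ' : IsTreePolynomial n Q') : IsTreePolynomial (m - 1 + (n - 1)) (gradDot i Q Q') :=
  isTreePolynomial_dotProduct (grad_mem_rootedTreeSpan i hQ) (grad_mem_rootedTreeSpan i hQ')

theorem pderiv_eq_zero_of_isHomogeneous_zero {σ : Type*} {Q : MvPolynomial σ ℂ}
    (hQ : Q.IsHomogeneous 0) (p : σ) : MvPolynomial.pderiv p Q = 0 := by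
  have h : Q.totalDegree = 0 := (MvPolynomial.totalDegree_zero_iff_isHomogeneous _).2 hQ
  rw [MvPolynomial.totalDegree_eq_zero_iff_eq_C.1 h, MvPolynomial.pderiv_C]

end Derivatives

/-! ### Linear substitutions of the vectors -/

section LinearSubstitution

variable {ι κ : Type} [Fintype κ] (M : ι → κ → ℝ)

/-- The substitution `a_i ↦ ∑ k, M i k • a_k`. -/
def linearSubst : VecPoly ι →ₐ[ℂ] VecPoly κ :=
  MvPolynomial.aeval fun p => ∑ k, MvPolynomial.C ((M p.1 k : ℝ) : ℂ) * MvPolynomial.X (k, p.2)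

theorem linearSubst_vecVar (i : ι) (μ : Fin 3) :
    linearSubst M (vecVar i μ) = ∑ k, ((M i k : ℝ) : ℂ) • vecVar k μ := by
  simp [linearSubst, vecVar, MvPolynomial.smul_eq_C_mul]

theorem at_linearSubst (Q : VecPoly ι) (a : κ → Fin 3 → ℝ) :
    (linearSubst M Q).at a = Q.at fun i => ∑ k, M i k • a k := by
  rw [← VecPoly.evalAt_apply, ← VecPoly.evalAt_apply, ← AlgHom.comp_apply]
  congr 1
  refine MvPolynomial.algHom_ext fun p => ?_
  simp [linearSubst, VecPoly.evalAt_apply, VecPoly.at]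

theorem isHomogeneous_linearSubst {m : ℕ} {Q : VecPoly ι} (hQ : Q.IsHomogeneous m) :
    (linearSubst M Q).IsHomogeneous m := by
  have := hQ.aeval (S := ℂ) (fun p : ι × Fin 3 =>
    ∑ k, MvPolynomial.C ((M p.1 k : ℝ) : ℂ) * MvPolynomial.X (k, p.2)) (n := 1) ?_
  · rwa [one_mul] at this
  · intro p
    refine MvPolynomial.IsHomogeneous.sum _ _ _ fun k _ => ?_
    simpa using (MvPolynomial.isHomogeneous_C _ _).mul (MvPolynomial.isHomogeneous_X ℂ (k, p.2))

theorem linearSubst_value_mem (s : LegTree ι) :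
    (fun μ => linearSubst M (s.value μ)) ∈ rootedTreeSpan κ s.legs := by
  induction s with
  | leg i =>
    have : (fun μ => linearSubst M ((LegTree.leg i).value μ)) =
        ∑ k, ((M i k : ℝ) : ℂ) • (LegTree.leg k).value := by
      ext1 μ
      simp only [LegTree.value, linearSubst_vecVar, Finset.sum_apply, Pi.smul_apply]
    rw [this]
    exact Submodule.sum_mem _ fun k _ =>
      Submodule.smul_mem _ _ (LegTree.leg k).value_mem_rootedTreeSpan
  | vertex s t hs ht =>
    refine (congrArg (· ∈ rootedTreeSpan κ _) ?_).mpr (crossProduct_mem_rootedTreeSpan hs ht)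
    ext1 μ
    fin_cases μ <;> simp [LegTree.value, cross_apply]

theorem isTreePolynomial_linearSubst {m : ℕ} {Q : VecPoly ι} (hQ : IsTreePolynomial m Q) :
    IsTreePolynomial m (linearSubst M Q) := by
  have h := Submodule.mem_map_of_mem (f := (linearSubst M).toLinearMap) hQ
  rw [Submodule.map_span] at h
  refine Submodule.span_le.2 ?_ h
  rintro _ ⟨_, ⟨s, t, rfl, rfl⟩, rfl⟩
  refine (congrArg (IsTreePolynomial _) ?_).mpr
    (isTreePolynomial_dotProduct (linearSubst_value_mem M s) (linearSubst_value_mem M t))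
  simp [dotProduct]

theorem pauli_sum_smul {κ : Type} [Fintype κ] (c : κ → ℝ) (a : κ → Fin 3 → ℝ) :
    pauli (∑ k, c k • a k) = ∑ k, (c k : ℂ) • pauli (a k) := by
  ext p q
  fin_cases p <;> fin_cases q <;>
    simp [pauli, Matrix.sum_apply, Finset.mul_sum, ← Finset.sum_add_distrib,
      ← Finset.sum_sub_distrib, mul_add, mul_sub, mul_left_comm]

theorem isSU2Invariant_linearSubst {Q : VecPoly ι} (hQ : IsSU2Invariant Q) :
    IsSU2Invariant (linearSubst M Q) := by
  intro U hU a b hab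
  rw [at_linearSubst, at_linearSubst]
  refine hQ U hU _ _ fun i => ?_
  simp only [pauli_sum_smul, hab, Finset.mul_sum, Finset.sum_mul, Matrix.mul_smul, Matrix.smul_mul]

theorem isInvariantForm_linearSubst {m : ℕ} {Q : VecPoly ι} (hQ : IsInvariantForm m Q) :
    IsInvariantForm m (linearSubst M Q) :=
  ⟨isHomogeneous_linearSubst M hQ.1, isSU2Invariant_linearSubst M hQ.2⟩

end LinearSubstitution

/-! ### The adjoint action of `SU(2)` by rotations -/

theorem pauli_injective : Function.Injective pauli := by
  intro v w h
  have h0 := congrFun (congrFun h 1) 0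
  have h2 := congrFun (congrFun h 0) 0
  simp only [pauli, Matrix.of_apply, Matrix.cons_val', Matrix.cons_val_zero, Matrix.cons_val_one,
    Matrix.cons_val_fin_one] at h0 h2
  have hr := congrArg Complex.re h0
  have hi := congrArg Complex.im h0
  have ht := congrArg Complex.re h2
  simp at hr hi ht
  ext μ
  fin_cases μ <;> assumption

/-- The vector `v` with `pauli v = A`, for a traceless Hermitian matrix `A`. -/
def unpauli (A : Matrix (Fin 2) (Fin 2) ℂ) : Fin 3 → ℝ := ![(A 1 0).re, (A 1 0).im, (A 0 0).re]

theorem pauli_unpauli {A : Matrix (Fin 2) (Fin 2) ℂ} (hA : A.IsHermitian) (ht : A.trace = 0) :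
    pauli (unpauli A) = A := by
  have h01 : A 0 1 = star (A 1 0) := (hA.apply 0 1).symm
  have h00 : star (A 0 0) = A 0 0 := hA.apply 0 0
  have h11 : A 1 1 = - A 0 0 := by
    rw [Matrix.trace_fin_two] at ht
    linear_combination ht
  have him : (A 0 0).im = 0 := by
    have := congrArg Complex.im h00
    simp at this
    linarith
  ext p q
  fin_cases p <;> fin_cases q <;> apply Complex.ext <;> simp [pauli, unpauli, h01, h11, him]

theorem isHermitian_pauli (v : Fin 3 → ℝ) : (pauli v).IsHermitian := by
  ext p q
  fin_cases p <;> fin_cases q <;> apply Complex.ext <;> simp [pauli]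

theorem trace_pauli (v : Fin 3 → ℝ) : (pauli v).trace = 0 := by
  simp [Matrix.trace_fin_two, pauli]

theorem trace_pauli_mul_pauli (v w : Fin 3 → ℝ) :
    (pauli v * pauli w).trace = 2 * ((dotProduct v w : ℝ) : ℂ) := by
  simp [Matrix.trace_fin_two, pauli, dotProduct, Fin.sum_univ_three]
  ring_nf
  simp

theorem pauli_crossProduct (v w : Fin 3 → ℝ) :
    pauli (crossProduct v w) =
      (-(Complex.I / 2)) • (pauli v * pauli w - pauli w * pauli v) := by
  ext p q
  fin_cases p <;> fin_cases q <;> apply Complex.ext <;>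
    simp [pauli, cross_apply] <;> ring

/-- `R` is the rotation of `ℝ³ ≅ su(2)` by which the matrix `U` acts. -/
def IsAdjointRotation (U : Matrix (Fin 2) (Fin 2) ℂ) (R : Matrix (Fin 3) (Fin 3) ℝ) : Prop :=
  ∀ v, pauli (R.mulVec v) = U * pauli v * star U

theorem star_mul_self_of_mem {U : Matrix (Fin 2) (Fin 2) ℂ}
    (hU : U ∈ Matrix.specialUnitaryGroup (Fin 2) ℂ) : star U * U = 1 :=
  (Matrix.mem_unitaryGroup_iff'.1 (Matrix.mem_specialUnitaryGroup_iff.1 hU).1)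

theorem dotProduct_eq_of_pauli_conj {U : Matrix (Fin 2) (Fin 2) ℂ} (hU : star U * U = 1)
    {v w v' w' : Fin 3 → ℝ} (hv : pauli v' = U * pauli v * star U)
    (hw : pauli w' = U * pauli w * star U) : dotProduct v' w' = dotProduct v w := by
  have h : (pauli v' * pauli w').trace = (pauli v * pauli w).trace := by
    have e : pauli v' * pauli w' = U * (pauli v * ((star U * U) * (pauli w * star U))) := by
      rw [hv, hw]; simp only [Matrix.mul_assoc]
    rw [e, hU, Matrix.one_mul, Matrix.trace_mul_comm, Matrix.mul_assoc, Matrix.mul_assoc, hU,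
      Matrix.mul_one]
  rw [trace_pauli_mul_pauli, trace_pauli_mul_pauli] at h
  exact_mod_cast mul_left_cancel₀ two_ne_zero h

theorem exists_isAdjointRotation {U : Matrix (Fin 2) (Fin 2) ℂ} (hU : star U * U = 1) :
    ∃ R, IsAdjointRotation U R := by
  have key : ∀ v, pauli (unpauli (U * pauli v * star U)) = U * pauli v * star U := fun v => by
    refine pauli_unpauli ?_ ?_
    · simpa [Matrix.star_eq_conjTranspose] using
        Matrix.isHermitian_mul_mul_conjTranspose U (isHermitian_pauli v)
    · rw [Matrix.trace_mul_comm, ← Matrix.mul_assoc, hU, Matrix.one_mul, trace_pauli]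
  have padd : ∀ v w, pauli (v + w) = pauli v + pauli w := fun v w => by
    simpa [Fin.sum_univ_two] using pauli_sum_smul (κ := Fin 2) ![1, 1] ![v, w]
  have psmul : ∀ (c : ℝ) v, pauli (c • v) = (c : ℂ) • pauli v := fun c v => by
    simpa using pauli_sum_smul (κ := Fin 1) (fun _ => c) (fun _ => v)
  let T : (Fin 3 → ℝ) →ₗ[ℝ] (Fin 3 → ℝ) :=
    { toFun := fun v => unpauli (U * pauli v * star U)
      map_add' := fun v w => pauli_injective <| by
        rw [key, padd, padd (unpauli _), key, key, Matrix.mul_add, Matrix.add_mul]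
      map_smul' := fun c v => pauli_injective <| by
        rw [RingHom.id_apply, key, psmul, psmul _ (unpauli _), key, Matrix.mul_smul,
          Matrix.smul_mul] }
  refine ⟨LinearMap.toMatrix' T, fun v => ?_⟩
  rw [LinearMap.toMatrix'_mulVec]
  exact key v

theorem IsAdjointRotation.mul_transpose {U : Matrix (Fin 2) (Fin 2) ℂ} (hU : star U * U = 1)
    {R : Matrix (Fin 3) (Fin 3) ℝ} (hR : IsAdjointRotation U R) : R * R.transpose = 1 := by
  rw [mul_eq_one_comm]
  ext p q
  have h := dotProduct_eq_of_pauli_conj hU (hR (Pi.single p 1)) (hR (Pi.single q 1))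
  simpa [Matrix.mul_apply, dotProduct, Matrix.one_apply, Pi.single_apply, eq_comm] using h

/-! ### Invariance of trees -/

/-- The contraction of a rooted tree with real vectors at its legs. -/
def LegTree.realValue {ι : Type} (a : ι → Fin 3 → ℝ) : LegTree ι → Fin 3 → ℝ
  | leg j => a j
  | vertex s t => crossProduct (s.realValue a) (t.realValue a)

theorem LegTree.at_value {ι : Type} (a : ι → Fin 3 → ℝ) (s : LegTree ι) (μ : Fin 3) :
    VecPoly.evalAt a (s.value μ) = (s.realValue a μ : ℂ) := by
  induction s generalizing μ with
  | leg j => simp [LegTree.value, vecVar, LegTree.realValue, VecPoly.evalAt]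
  | vertex s t hs ht =>
    fin_cases μ <;> simp [LegTree.value, LegTree.realValue, cross_apply, hs, ht]

theorem LegTree.pauli_realValue {ι : Type} {U : Matrix (Fin 2) (Fin 2) ℂ} (hU : star U * U = 1)
    {a b : ι → Fin 3 → ℝ} (hab : ∀ j, pauli (b j) = U * pauli (a j) * star U) (s : LegTree ι) :
    pauli (s.realValue b) = U * pauli (s.realValue a) * star U := by
  induction s with
  | leg j => exact hab j
  | vertex s t hs ht =>
    have e : ∀ x y : Matrix (Fin 2) (Fin 2) ℂ,
        U * x * star U * (U * y * star U) = U * (x * y) * star U := fun x y => by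
      calc U * x * star U * (U * y * star U) = U * x * (star U * U) * y * star U := by
            simp only [Matrix.mul_assoc]
        _ = _ := by rw [hU]; simp only [Matrix.mul_assoc, Matrix.one_mul]
    rw [LegTree.realValue, LegTree.realValue, pauli_crossProduct, pauli_crossProduct, hs, ht, e, e,
      Matrix.mul_smul, Matrix.smul_mul, Matrix.mul_sub, Matrix.sub_mul]

theorem LegTree.isHomogeneous_value {ι : Type} (s : LegTree ι) (μ : Fin 3) :
    (s.value μ).IsHomogeneous s.legs := by
  induction s generalizing μ with
  | leg j => exact MvPolynomial.isHomogeneous_X _ _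
  | vertex s t hs ht =>
    have h : ∀ p q, (s.value p * t.value q - s.value q * t.value p).IsHomogeneous
        (s.legs + t.legs) := fun p q => ((hs p).mul (ht q)).sub ((hs q).mul (ht p))
    fin_cases μ
    · exact h 1 2
    · exact h 2 0
    · exact h 0 1

/-- The invariant forms of order `m`, as a submodule. -/
def invariantForms (ι : Type) (m : ℕ) : Submodule ℂ (VecPoly ι) where
  carrier := {Q | IsInvariantForm m Q}
  add_mem' := fun {Q Q'} hQ hQ' => ⟨hQ.1.add hQ'.1, fun U hU a b hab => by
    have h := hQ.2 U hU a b hab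
    have h' := hQ'.2 U hU a b hab
    simp only [← VecPoly.evalAt_apply, map_add] at h h' ⊢
    rw [h, h']⟩
  zero_mem' := ⟨MvPolynomial.isHomogeneous_zero _ _ _, fun U hU a b hab => by
    simp only [← VecPoly.evalAt_apply, map_zero]⟩
  smul_mem' := fun c Q hQ => ⟨(MvPolynomial.homogeneousSubmodule _ _ m).smul_mem c hQ.1,
    fun U hU a b hab => by
      have h := hQ.2 U hU a b hab
      simp only [← VecPoly.evalAt_apply, map_smul] at h ⊢
      rw [h]⟩

/-- Trees are invariant, since the cross product is the commutator of `su(2)`. -/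
theorem IsTreePolynomial.isInvariantForm {ι : Type} {m : ℕ} {Q : VecPoly ι}
    (hQ : IsTreePolynomial m Q) : IsInvariantForm m Q := by
  refine (Submodule.span_le (p := invariantForms ι m)).2 ?_ hQ
  rintro _ ⟨s, t, rfl, rfl⟩
  refine ⟨MvPolynomial.IsHomogeneous.sum _ _ _ fun μ _ =>
    (s.isHomogeneous_value μ).mul (t.isHomogeneous_value μ), fun U hU a b hab => ?_⟩
  have hU' := star_mul_self_of_mem hU
  have h := dotProduct_eq_of_pauli_conj hU' (LegTree.pauli_realValue hU' hab s)
    (LegTree.pauli_realValue hU' hab t)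
  have e : ∀ c : ι → Fin 3 → ℝ, VecPoly.evalAt c (dotProduct s.value t.value) =
      ((dotProduct (s.realValue c) (t.realValue c) : ℝ) : ℂ) := fun c => by
    simp [dotProduct, LegTree.at_value]
  rw [← VecPoly.evalAt_apply, ← VecPoly.evalAt_apply, e, e, h]

/-! ### Invariance under the gradient pairing and the Laplacian -/

section Rotation

variable {ι : Type} (R : Matrix (Fin 3) (Fin 3) ℝ)

/-- The substitution `a_j ↦ R a_j`. -/
def rotate : VecPoly ι →ₐ[ℂ] VecPoly ι :=
  MvPolynomial.aeval fun p => ∑ ν, MvPolynomial.C ((R p.2 ν : ℝ) : ℂ) * MvPolynomial.X (p.1, ν)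

theorem at_rotate (Q : VecPoly ι) (a : ι → Fin 3 → ℝ) :
    (rotate R Q).at a = Q.at fun j => R.mulVec (a j) := by
  rw [← VecPoly.evalAt_apply, ← VecPoly.evalAt_apply, ← AlgHom.comp_apply]
  congr 1
  refine MvPolynomial.algHom_ext fun p => ?_
  simp [rotate, VecPoly.evalAt, Matrix.mulVec, dotProduct]

theorem VecPoly.ext_at {Q Q' : VecPoly ι} (h : ∀ a, Q.at a = Q'.at a) : Q = Q' := by
  refine MvPolynomial.funext_set (fun _ => Set.range (fun x : ℝ => (x : ℂ)))
    (fun _ => Set.infinite_range_of_injective Complex.ofReal_injective) fun x hx => ?_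
  choose y hy using fun p => hx p (Set.mem_univ p)
  have := h fun j μ => y (j, μ)
  simpa [VecPoly.at, hy] using this

/-- Invariance as a polynomial identity, to which derivatives can be applied. -/
theorem isSU2Invariant_iff {Q : VecPoly ι} :
    IsSU2Invariant Q ↔ ∀ U ∈ Matrix.specialUnitaryGroup (Fin 2) ℂ,
      ∀ R, IsAdjointRotation U R → rotate R Q = Q := by
  constructor
  · intro h U hU R hR
    refine VecPoly.ext_at fun a => ?_
    rw [at_rotate]
    exact h U hU _ _ fun j => hR (a j)
  · intro h U hU a b hab
    obtain ⟨R, hR⟩ := exists_isAdjointRotation (star_mul_self_of_mem hU)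
    have hb : b = fun j => R.mulVec (a j) := by
      ext1 j
      exact pauli_injective ((hab j).trans (hR (a j)).symm)
    rw [hb, ← at_rotate, h U hU R hR]

theorem pderiv_rotate (i : ι) (μ : Fin 3) (Q : VecPoly ι) :
    MvPolynomial.pderiv (i, μ) (rotate R Q) =
      ∑ ν, MvPolynomial.C ((R ν μ : ℝ) : ℂ) * rotate R (MvPolynomial.pderiv (i, ν) Q) := by
  classical
  induction Q using MvPolynomial.induction_on with
  | C c => simp [rotate]
  | add p q hp hq => simp only [map_add, hp, hq, mul_add, Finset.sum_add_distrib]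
  | mul_X p x hp =>
    have hX : MvPolynomial.pderiv (i, μ) (rotate R (MvPolynomial.X x : VecPoly ι)) =
        ∑ ν, MvPolynomial.C ((R ν μ : ℝ) : ℂ) *
          rotate R (MvPolynomial.pderiv (i, ν) (MvPolynomial.X x)) := by
      obtain ⟨j, κ⟩ := x
      by_cases hij : j = i
      · subst hij
        simp [rotate, MvPolynomial.pderiv_X, Pi.single_apply, apply_ite]
      · simp [rotate, hij]
    rw [map_mul, MvPolynomial.pderiv_mul, hp, hX]
    rw [Finset.sum_mul, Finset.mul_sum, ← Finset.sum_add_distrib]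
    refine Finset.sum_congr rfl fun ν _ => ?_
    rw [MvPolynomial.pderiv_mul, map_add, map_mul, map_mul]
    ring

theorem sum_C_mul_C_of_mul_transpose {R : Matrix (Fin 3) (Fin 3) ℝ} (hR : R * R.transpose = 1)
    (F : Fin 3 → Fin 3 → VecPoly ι) :
    ∑ μ, ∑ ν, ∑ ν', MvPolynomial.C ((R ν μ : ℝ) : ℂ) * MvPolynomial.C ((R ν' μ : ℝ) : ℂ) * F ν ν' =
      ∑ ν, F ν ν := by
  have hR' : ∀ ν ν', ∑ μ, (R ν μ : ℂ) * (R ν' μ : ℂ) = if ν = ν' then 1 else 0 := fun ν ν' => by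
    have := congrFun (congrFun hR ν) ν'
    rw [Matrix.mul_apply, Matrix.one_apply] at this
    simp only [Matrix.transpose_apply] at this
    split_ifs at this ⊢ <;> exact_mod_cast this
  rw [Finset.sum_comm]
  refine Finset.sum_congr rfl fun ν _ => ?_
  rw [Finset.sum_comm]
  simp only [← Finset.sum_mul, ← map_mul, ← map_sum, hR']
  simp

theorem gradDot_rotate {R : Matrix (Fin 3) (Fin 3) ℝ} (hR : R * R.transpose = 1) (i : ι)
    (Q Q' : VecPoly ι) : gradDot i (rotate R Q) (rotate R Q') = rotate R (gradDot i Q Q') := by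
  simp only [gradDot_apply, pderiv_rotate, map_sum, map_mul, Finset.sum_mul_sum]
  refine Eq.trans ?_ (sum_C_mul_C_of_mul_transpose hR fun ν ν' =>
    rotate R (MvPolynomial.pderiv (i, ν) Q) * rotate R (MvPolynomial.pderiv (i, ν') Q'))
  exact Finset.sum_congr rfl fun μ _ => Finset.sum_congr rfl fun ν _ =>
    Finset.sum_congr rfl fun ν' _ => by ring

theorem laplacian_rotate {R : Matrix (Fin 3) (Fin 3) ℝ} (hR : R * R.transpose = 1) (i : ι)
    (Q : VecPoly ι) : laplacian i (rotate R Q) = rotate R (laplacian i Q) := by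
  simp only [laplacian_apply, pderiv_rotate, map_sum, MvPolynomial.pderiv_C_mul, Finset.mul_sum]
  refine Eq.trans ?_ (sum_C_mul_C_of_mul_transpose hR fun ν ν' =>
    rotate R (MvPolynomial.pderiv (i, ν') (MvPolynomial.pderiv (i, ν) Q)))
  exact Finset.sum_congr rfl fun μ _ => Finset.sum_congr rfl fun ν _ =>
    Finset.sum_congr rfl fun ν' _ => by ring

end Rotation

theorem isInvariantForm_gradDot {ι : Type} (i : ι) {m n : ℕ} {Q Q' : VecPoly ι}
    (hQ : IsInvariantForm m Q) (hQ' : IsInvariantForm n Q') :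
    IsInvariantForm (m - 1 + (n - 1)) (gradDot i Q Q') := by
  refine ⟨MvPolynomial.IsHomogeneous.sum _ _ _ fun μ _ => hQ.1.pderiv.mul hQ'.1.pderiv, ?_⟩
  rw [isSU2Invariant_iff]
  intro U hU R hR
  rw [← gradDot_rotate (hR.mul_transpose (star_mul_self_of_mem hU)),
    isSU2Invariant_iff.1 hQ.2 U hU R hR, isSU2Invariant_iff.1 hQ'.2 U hU R hR]

theorem isInvariantForm_laplacian {ι : Type} (i : ι) {m : ℕ} {Q : VecPoly ι}
    (hQ : IsInvariantForm m Q) : IsInvariantForm (m - 1 - 1) (laplacian i Q) := by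
  refine ⟨?_, ?_⟩
  · rw [laplacian_apply]
    exact MvPolynomial.IsHomogeneous.sum _ _ _ fun μ _ => hQ.1.pderiv.pderiv
  rw [isSU2Invariant_iff]
  intro U hU R hR
  rw [← laplacian_rotate (hR.mul_transpose (star_mul_self_of_mem hU)),
    isSU2Invariant_iff.1 hQ.2 U hU R hR]

/-! ### The terms of the effective exponent -/

/-- The possible coefficients, at order `t ^ k` and after `j` contractions of pairs of legs, of
`h = K⁻¹` times an exponent: tree polynomials of order `k + 2`, and `h ^ (l + 1)` times an invariant
form of order `d` with `d + 2 l = k`, as functions of `h`. The bound on the degree by `3 k - 2 j`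
leaves nothing once `3 k < 2 j`. -/
def expansionTerms (ι : Type) (j k : ℕ) : Submodule ℂ (ℂ → VecPoly ι) :=
  Submodule.span ℂ
    ({f | k + 2 + 2 * j ≤ 3 * k ∧ ∃ T, IsTreePolynomial (k + 2) T ∧ f = fun _ => T} ∪
      {f | ∃ d l Q, d + 2 * l = k ∧ d + 2 * j ≤ 3 * k ∧ IsInvariantForm d Q ∧
        f = fun h => h ^ (l + 1) • Q})

section ExpansionTerms

variable {ι : Type} {j k : ℕ}

theorem const_mem_expansionTerms {T : VecPoly ι} (hk : k + 2 + 2 * j ≤ 3 * k)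
    (hT : IsTreePolynomial (k + 2) T) : (fun _ => T) ∈ expansionTerms ι j k :=
  Submodule.subset_span (Or.inl ⟨hk, T, hT, rfl⟩)

theorem pow_smul_mem_expansionTerms {d : ℕ} (l : ℕ) {Q : VecPoly ι} (hd : d + 2 * l = k)
    (hk : d + 2 * j ≤ 3 * k) (hQ : IsInvariantForm d Q) :
    (fun h => h ^ (l + 1) • Q) ∈ expansionTerms ι j k :=
  Submodule.subset_span (Or.inr ⟨d, l, Q, hd, hk, hQ, rfl⟩)

theorem eq_zero_of_mem_expansionTerms {f : ℂ → VecPoly ι} (hf : f ∈ expansionTerms ι j k)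
    (hjk : 3 * k < 2 * j) : f = 0 := by
  refine (Submodule.mem_bot ℂ).1 (Submodule.span_le.2 ?_ hf)
  rintro _ (⟨h, _⟩ | ⟨d, l, Q, _, h, _⟩) <;> omega

/-- An element of `expansionTerms` is a tree polynomial plus powers of `h` times invariant forms,
as in `exponent`. -/
theorem exists_eq_of_mem_expansionTerms {f : ℂ → VecPoly ι} (hf : f ∈ expansionTerms ι j k) :
    ∃ (T : VecPoly ι) (P : ℕ → VecPoly ι), IsTreePolynomial (k + 2) T ∧
      (∀ l, 2 * l ≤ k → IsInvariantForm (k - 2 * l) (P l)) ∧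
      ∀ h, f h = T + ∑ l ∈ Finset.range (k / 2 + 1), h ^ (l + 1) • P l := by
  induction hf using Submodule.span_induction with
  | mem f hf =>
    rcases hf with ⟨_, T, hT, rfl⟩ | ⟨d, l, Q, hd, _, hQ, rfl⟩
    · exact ⟨T, 0, hT, fun l _ => (invariantForms ι _).zero_mem, by simp⟩
    · refine ⟨0, Pi.single l Q, Submodule.zero_mem _, fun l' hl' => ?_, fun h => ?_⟩
      · by_cases hll : l' = l
        · subst hll
          rw [Pi.single_eq_same, ← hd, Nat.add_sub_cancel]
          exact hQ
        · rw [Pi.single_eq_of_ne hll]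
          exact (invariantForms ι _).zero_mem
      · rw [Finset.sum_eq_single l (fun l' _ hl' => by rw [Pi.single_eq_of_ne hl', smul_zero])
          (fun hl => absurd (Finset.mem_range.2 (by omega)) hl), Pi.single_eq_same, zero_add]
  | zero => exact ⟨0, 0, Submodule.zero_mem _, fun l _ => (invariantForms ι _).zero_mem, by simp⟩
  | add f g _ _ hf hg =>
    obtain ⟨T, P, hT, hP, h⟩ := hf
    obtain ⟨T', P', hT', hP', h'⟩ := hg
    refine ⟨T + T', P + P', Submodule.add_mem _ hT hT',
      fun l hl => (invariantForms ι _).add_mem (hP l hl) (hP' l hl), fun x => ?_⟩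
    simp only [Pi.add_apply, h, h', smul_add, Finset.sum_add_distrib]
    abel
  | smul c f _ hf =>
    obtain ⟨T, P, hT, hP, h⟩ := hf
    refine ⟨c • T, c • P, Submodule.smul_mem _ _ hT,
      fun l hl => (invariantForms ι _).smul_mem c (hP l hl), fun x => ?_⟩
    simp only [Pi.smul_apply, h, smul_add, Finset.smul_sum, smul_comm c]

/-- Contracting two legs of one term gains a power of `h`, that is a loop. -/
theorem smul_laplacian_mem_expansionTerms (i : ι) {f : ℂ → VecPoly ι}
    (hf : f ∈ expansionTerms ι j k) :
    (fun h => h • laplacian i (f h)) ∈ expansionTerms ι (j + 1) k := by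
  induction hf using Submodule.span_induction with
  | mem f hf =>
    rcases hf with ⟨hk, T, hT, rfl⟩ | ⟨d, l, Q, hd, hk, hQ, rfl⟩
    · simpa using pow_smul_mem_expansionTerms (j := j + 1) 0 (by omega) (by omega)
        (isInvariantForm_laplacian i hT.isInvariantForm)
    · by_cases h2 : d < 2
      · have h0 : laplacian i Q = 0 := by
          rw [laplacian_apply]
          refine Finset.sum_eq_zero fun μ _ =>
            pderiv_eq_zero_of_isHomogeneous_zero ?_ _
          have := hQ.1.pderiv (i := (i, μ))
          rwa [show d - 1 = 0 by omega] at this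
        simp only [map_smul, h0, smul_zero]
        exact Submodule.zero_mem _
      · simp only [map_smul, smul_smul, ← pow_succ']
        exact pow_smul_mem_expansionTerms (l + 1) (by omega) (by omega)
          (isInvariantForm_laplacian i hQ)
  | zero =>
    simp only [Pi.zero_apply, map_zero, smul_zero]
    exact Submodule.zero_mem _
  | add f g _ _ hf hg =>
    convert Submodule.add_mem _ hf hg using 1
    ext1 h
    simp
  | smul c f _ hf =>
    convert Submodule.smul_mem _ c hf using 1
    ext1 h
    simp [smul_comm c h]

/-- The gradient pairing of functions of `h`, as a bilinear map. -/
def gradDotFun (i : ι) : (ℂ → VecPoly ι) →ₗ[ℂ] (ℂ → VecPoly ι) →ₗ[ℂ] (ℂ → VecPoly ι) :=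
  LinearMap.mk₂ ℂ (fun f g h => gradDot i (f h) (g h)) (fun f f' g => by ext1; simp)
    (fun c f g => by ext1; simp) (fun f g g' => by ext1; simp) (fun c f g => by ext1; simp)

/-- Joining two terms along a contracted pair of legs joins trees to a tree and creates no loop. -/
theorem gradDot_mem_expansionTerms (i : ι) {j' k' : ℕ} {f g : ℂ → VecPoly ι}
    (hf : f ∈ expansionTerms ι j k) (hg : g ∈ expansionTerms ι j' k') :
    (fun h => gradDot i (f h) (g h)) ∈ expansionTerms ι (j + j' + 1) (k + k') := by
  have h := Submodule.apply_mem_map₂ (gradDotFun i) hf hg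
  rw [expansionTerms, expansionTerms, Submodule.map₂_span_span] at h
  have zero_left : ∀ {Q : VecPoly ι}, IsInvariantForm 0 Q → ∀ Q', gradDot i Q Q' = 0 := by
    intro Q hQ Q'
    rw [gradDot_apply]
    exact Finset.sum_eq_zero fun μ _ => by
      rw [pderiv_eq_zero_of_isHomogeneous_zero hQ.1, zero_mul]
  have comm : ∀ Q Q', gradDot i Q Q' = gradDot i Q' Q := fun Q Q' => by
    simp only [gradDot_apply, mul_comm]
  refine Submodule.span_le.2 ?_ h
  rintro _ ⟨f, hf, g, hg, rfl⟩
  change (fun h => gradDot i (f h) (g h)) ∈ expansionTerms ι (j + j' + 1) (k + k')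
  have mixed : ∀ {k k' j j' d l : ℕ} {T Q : VecPoly ι}, k + 2 + 2 * j ≤ 3 * k →
      IsTreePolynomial (k + 2) T → d + 2 * l = k' → d + 2 * j' ≤ 3 * k' → IsInvariantForm d Q →
      (fun h => gradDot i T (h ^ (l + 1) • Q)) ∈ expansionTerms ι (j + j' + 1) (k + k') := by
    intro k k' j j' d l T Q hk hT hd hk' hQ
    simp only [map_smul]
    rcases Nat.eq_zero_or_pos d with rfl | hd0
    · simp only [comm T, zero_left hQ, smul_zero]
      exact Submodule.zero_mem _
    · exact pow_smul_mem_expansionTerms l (by omega) (by omega)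
        (isInvariantForm_gradDot i hT.isInvariantForm hQ)
  rcases hf with ⟨hk, T, hT, rfl⟩ | ⟨d, l, Q, hd, hk, hQ, rfl⟩ <;>
    rcases hg with ⟨hk', T', hT', rfl⟩ | ⟨d', l', Q', hd', hk', hQ', rfl⟩
  · refine const_mem_expansionTerms (by omega) ?_
    have := isTreePolynomial_gradDot i hT hT'
    rwa [show k + 2 - 1 + (k' + 2 - 1) = k + k' + 2 by omega] at this
  · exact mixed hk hT hd' hk' hQ'
  · simp only [comm _ T', add_comm j, add_comm k]
    exact mixed hk' hT' hd hk hQ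
  · simp only [map_smul, LinearMap.smul_apply, smul_smul, ← pow_add]
    rcases Nat.eq_zero_or_pos d with rfl | hd0
    · simp only [zero_left hQ, smul_zero]
      exact Submodule.zero_mem _
    rcases Nat.eq_zero_or_pos d' with rfl | hd0'
    · simp only [comm Q, zero_left hQ', smul_zero]
      exact Submodule.zero_mem _
    · have e : ∀ h : ℂ, h ^ (l + 1 + (l' + 1)) = h ^ (l + l' + 1 + 1) := fun h => by ring
      simp only [add_comm (l' + 1), e]
      exact pow_smul_mem_expansionTerms (l + l' + 1) (by omega) (by omega)
        (isInvariantForm_gradDot i hQ hQ')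

end ExpansionTerms

/-! ### The flow of the effective exponent -/

/-- The coefficient of `s ^ j t ^ k` in the solution of `∂ₛ U = h Δ U + ⟨∇ U, ∇ U⟩` with initial
value `∑ V k t ^ k`. -/
def flow {ι : Type} (i : ι) (V : ℕ → ℂ → VecPoly ι) : ℕ → ℕ → ℂ → VecPoly ι
  | 0, k, h => V k h
  | j + 1, k, h => ((j : ℂ) + 1)⁻¹ • (h • laplacian i (flow i V j k h) +
      ∑ p : Fin (j + 1), ∑ q ∈ Finset.HasAntidiagonal.antidiagonal k,
        gradDot i (flow i V p q.1 h) (flow i V (j - p) q.2 h))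

section Flow

variable {ι : Type} (i : ι) {V : ℕ → ℂ → VecPoly ι}

theorem flow_succ (j k : ℕ) (h : ℂ) : ((j : ℂ) + 1) • flow i V (j + 1) k h =
    h • laplacian i (flow i V j k h) + ∑ p ∈ Finset.HasAntidiagonal.antidiagonal j,
      ∑ q ∈ Finset.HasAntidiagonal.antidiagonal k,
        gradDot i (flow i V p.1 q.1 h) (flow i V p.2 q.2 h) := by
  rw [flow, smul_inv_smul₀ (Nat.cast_add_one_ne_zero j),
    Finset.Nat.sum_antidiagonal_eq_sum_range_succ_mk, Finset.sum_range]

theorem flow_mem_expansionTerms (hV : ∀ k, V k ∈ expansionTerms ι 0 k) (j k : ℕ) :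
    flow i V j k ∈ expansionTerms ι j k := by
  induction j using Nat.strong_induction_on generalizing k with
  | _ j ih =>
    cases j with
    | zero =>
      convert hV k using 1
      ext1 h
      rw [flow]
    | succ j =>
      have h1 := smul_laplacian_mem_expansionTerms i (ih j (by omega) k)
      have h2 : (∑ p : Fin (j + 1), ∑ q ∈ Finset.HasAntidiagonal.antidiagonal k,
          fun h => gradDot i (flow i V p q.1 h) (flow i V (j - p) q.2 h)) ∈
            expansionTerms ι (j + 1) k := by
        refine Submodule.sum_mem _ fun p _ => Submodule.sum_mem _ fun q hq => ?_
        have := gradDot_mem_expansionTerms i (ih p (by omega) q.1) (ih (j - p) (by omega) q.2)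
        rwa [Finset.HasAntidiagonal.mem_antidiagonal.1 hq,
          show (p : ℕ) + (j - p) + 1 = j + 1 by omega] at this
      convert Submodule.smul_mem _ (((j : ℂ) + 1)⁻¹) (Submodule.add_mem _ h1 h2) using 1
      ext1 h
      rw [flow]
      simp [Finset.sum_apply]

/-- The degree bound terminates the flow at every order in `t`. -/
theorem flow_eq_zero (hV : ∀ k, V k ∈ expansionTerms ι 0 k) {j k : ℕ} (hjk : 3 * k < 2 * j)
    (h : ℂ) : flow i V j k h = 0 := by
  rw [eq_zero_of_mem_expansionTerms (flow_mem_expansionTerms i hV j k) hjk]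
  rfl

end Flow

/-! ### The exponential of the flow solves the heat equation -/

/-- The derivation of `A[s]` that applies a derivation of `A` to every coefficient. -/
def polyDerivation {A : Type*} [CommRing A] [Algebra ℚ A] (D : Derivation ℚ A A) :
    Derivation ℚ (Polynomial A) (Polynomial A) :=
  LinearMap.compDer
    (PolynomialModule.equivPolynomialSelf (R := A)).toLinearMap D.mapCoeffs

theorem coeff_polyDerivation {A : Type*} [CommRing A] [Algebra ℚ A] (D : Derivation ℚ A A)
    (f : Polynomial A) (n : ℕ) : (polyDerivation D f).coeff n = D (f.coeff n) := rfl

section Heat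

variable {ι : Type} (i : ι) {V : ℕ → ℂ → VecPoly ι}

/-- The solution `W = K ∑ₖ (∑ⱼ flow j k s ^ j) t ^ k` of the flow at `h = K⁻¹`, as a power series in
`t` over the polynomials in `s`. The bound `2 k` on `j` loses nothing, by `flow_eq_zero`. -/
def flowSeries (V : ℕ → ℂ → VecPoly ι) (K : ℂ) : PowerSeries (Polynomial (VecPoly ι)) :=
  PowerSeries.mk fun k => ∑ j ∈ Finset.range (2 * k + 1),
    Polynomial.monomial j (K • flow i V j k K⁻¹)

theorem coeff_flowSeries (hV : ∀ k, V k ∈ expansionTerms ι 0 k) (K : ℂ) (j k : ℕ) :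
    (PowerSeries.coeff k (flowSeries i V K)).coeff j = K • flow i V j k K⁻¹ := by
  simp only [flowSeries, PowerSeries.coeff_mk, Polynomial.finsetSum_coeff,
    Polynomial.coeff_monomial, Finset.sum_ite_eq', Finset.mem_range]
  split_ifs with h
  · rfl
  · rw [flow_eq_zero i hV (by omega), smul_zero]

/-- The derivation of `VecPoly ι [s] ⟦t⟧` by the component `μ` of `a i`. -/
def seriesPDeriv (μ : Fin 3) : Derivation ℚ (PowerSeries (Polynomial (VecPoly ι)))
    (PowerSeries (Polynomial (VecPoly ι))) :=
  PowerSeries.coeffDerivation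
    (polyDerivation ((MvPolynomial.pderiv (i, μ) : Derivation ℂ _ _).restrictScalars ℚ))

theorem coeff_seriesPDeriv (μ : Fin 3) (f : PowerSeries (Polynomial (VecPoly ι))) (j k : ℕ) :
    (PowerSeries.coeff k (seriesPDeriv i μ f)).coeff j =
      MvPolynomial.pderiv (i, μ) ((PowerSeries.coeff k f).coeff j) := by
  rw [seriesPDeriv, PowerSeries.coeff_coeffDerivation, coeff_polyDerivation]
  rfl

/-- The derivation of `VecPoly ι [s] ⟦t⟧` by `s`. -/
def seriesDerivS (ι : Type) : Derivation ℚ (PowerSeries (Polynomial (VecPoly ι)))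
    (PowerSeries (Polynomial (VecPoly ι))) :=
  PowerSeries.coeffDerivation
    ((Polynomial.derivative' (R := VecPoly ι)).restrictScalars ℚ)

theorem coeff_seriesDerivS (f : PowerSeries (Polynomial (VecPoly ι))) (j k : ℕ) :
    (PowerSeries.coeff k (seriesDerivS ι f)).coeff j =
      ((j : ℂ) + 1) • (PowerSeries.coeff k f).coeff (j + 1) := by
  rw [seriesDerivS, PowerSeries.coeff_coeffDerivation]
  change (Polynomial.derivative _).coeff j = _
  rw [Polynomial.coeff_derivative, mul_comm, MvPolynomial.smul_eq_C_mul]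
  simp

/-- The flow equation for the exponent `W`. -/
theorem seriesDerivS_flowSeries (hV : ∀ k, V k ∈ expansionTerms ι 0 k) {K : ℂ} (hK : K ≠ 0) :
    seriesDerivS ι (flowSeries i V K) = (K⁻¹ : ℂ) • ∑ μ,
      (seriesPDeriv i μ (seriesPDeriv i μ (flowSeries i V K)) +
        seriesPDeriv i μ (flowSeries i V K) * seriesPDeriv i μ (flowSeries i V K)) := by
  ext1 k
  ext1 j
  rw [coeff_seriesDerivS, coeff_flowSeries i hV, smul_comm, flow_succ]
  have hc : ∀ F : PowerSeries (Polynomial (VecPoly ι)),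
      (PowerSeries.coeff k ((K⁻¹ : ℂ) • F)).coeff j = (K⁻¹ : ℂ) • (PowerSeries.coeff k F).coeff j :=
    fun F => rfl
  rw [hc, map_sum, Polynomial.finsetSum_coeff]
  simp only [map_add, Polynomial.coeff_add, coeff_seriesPDeriv, coeff_flowSeries i hV,
    PowerSeries.coeff_mul, Polynomial.finsetSum_coeff, Polynomial.coeff_mul, Finset.sum_add_distrib,
    Derivation.map_smul, smul_add, laplacian_apply, gradDot_apply, Finset.smul_sum]
  congr 1
  · exact Finset.sum_congr rfl fun μ _ => smul_comm _ _ _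
  · rw [Finset.sum_comm, Finset.sum_comm (s := Finset.univ)]
    refine Finset.sum_congr rfl fun q _ => ?_
    rw [Finset.sum_comm (s := Finset.univ)]
    refine Finset.sum_congr rfl fun p _ => Finset.sum_congr rfl fun μ _ => ?_
    rw [smul_mul_smul_comm, smul_smul, inv_mul_cancel_left₀ hK]

theorem constantCoeff_flowSeries (hV0 : V 0 = 0) (K : ℂ) :
    PowerSeries.constantCoeff (flowSeries i V K) = 0 := by
  have h0 : flow i V 0 0 K⁻¹ = 0 := by
    rw [flow, hV0, Pi.zero_apply]
  rw [← PowerSeries.coeff_zero_eq_constantCoeff_apply, flowSeries, PowerSeries.coeff_mk]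
  simp [h0]

/-- The exponential of a solution of the flow solves the heat equation. -/
theorem seriesDerivS_expOf (hV : ∀ k, V k ∈ expansionTerms ι 0 k) (hV0 : V 0 = 0) {K : ℂ}
    (hK : K ≠ 0) :
    seriesDerivS ι (PowerSeries.expOf (flowSeries i V K)) = (K⁻¹ : ℂ) • ∑ μ,
      seriesPDeriv i μ (seriesPDeriv i μ (PowerSeries.expOf (flowSeries i V K))) := by
  have h0 := constantCoeff_flowSeries i hV0 K
  have hS : ∀ μ, seriesPDeriv i μ (PowerSeries.expOf (flowSeries i V K)) =
      seriesPDeriv i μ (flowSeries i V K) * PowerSeries.expOf (flowSeries i V K) := fun μ =>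
    PowerSeries.coeffDerivation_expOf _ h0
  rw [seriesDerivS, PowerSeries.coeffDerivation_expOf _ h0, ← seriesDerivS,
    seriesDerivS_flowSeries i hV hK]
  simp only [hS, Derivation.leibniz, smul_eq_mul]
  rw [smul_mul_assoc, Finset.sum_mul]
  congr 1
  exact Finset.sum_congr rfl fun μ _ => by ring

end Heat

/-! ### The heat operator and the Schwinger-Dyson equations -/

section HeatOperator

variable {ι : Type} (i : ι)

theorem pderiv_comm (p q : ι × Fin 3) (f : VecPoly ι) :
    MvPolynomial.pderiv p (MvPolynomial.pderiv q f) =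
      MvPolynomial.pderiv q (MvPolynomial.pderiv p f) := by
  classical
  have h : ⁅(MvPolynomial.pderiv p : Derivation ℂ (VecPoly ι) (VecPoly ι)),
      (MvPolynomial.pderiv q : Derivation ℂ (VecPoly ι) (VecPoly ι))⁆ = 0 := by
    refine MvPolynomial.derivation_ext fun x => ?_
    rw [Derivation.commutator_apply]
    simp [MvPolynomial.pderiv_X, Pi.single_apply, apply_ite]
  have := congrArg (fun D => D f) h
  rwa [Derivation.commutator_apply, Derivation.coe_zero, Pi.zero_apply, sub_eq_zero] at this

theorem laplacian_pderiv (p : ι × Fin 3) (f : VecPoly ι) :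
    laplacian i (MvPolynomial.pderiv p f) = MvPolynomial.pderiv p (laplacian i f) := by
  simp only [laplacian_apply, map_sum, pderiv_comm _ p]

theorem laplacian_X_mul (μ : Fin 3) (f : VecPoly ι) :
    laplacian i (MvPolynomial.X (i, μ) * f) =
      MvPolynomial.X (i, μ) * laplacian i f + (2 : ℂ) • MvPolynomial.pderiv (i, μ) f := by
  classical
  have h : ∀ ν,
      MvPolynomial.pderiv (i, ν) (MvPolynomial.pderiv (i, ν) (MvPolynomial.X (i, μ) * f)) =
      MvPolynomial.X (i, μ) * MvPolynomial.pderiv (i, ν) (MvPolynomial.pderiv (i, ν) f) +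
        if ν = μ then (2 : ℂ) • MvPolynomial.pderiv (i, μ) f else 0 := fun ν => by
    by_cases hν : ν = μ
    · subst hν
      simp [two_smul]
      ring
    · have : ((i, μ) : ι × Fin 3) ≠ (i, ν) := fun h => hν (Prod.ext_iff.1 h).2.symm
      simp [MvPolynomial.pderiv_X_of_ne this, hν]
  simp only [laplacian_apply, h, Finset.sum_add_distrib, Finset.mul_sum]
  simp

theorem laplacian_X_mul_of_ne {p : ι × Fin 3} (hp : p.1 ≠ i) (f : VecPoly ι) :
    laplacian i (MvPolynomial.X p * f) = MvPolynomial.X p * laplacian i f := by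
  have h : ∀ ν, p ≠ (i, ν) := fun ν h => hp (by rw [h])
  simp [laplacian_apply, MvPolynomial.pderiv_X_of_ne (h _),
    Finset.mul_sum]

theorem laplacian_pow_X_mul (μ : Fin 3) (f : VecPoly ι) (j : ℕ) :
    (laplacian i ^ (j + 1)) (MvPolynomial.X (i, μ) * f) =
      MvPolynomial.X (i, μ) * (laplacian i ^ (j + 1)) f +
        (2 * ((j : ℂ) + 1)) • (laplacian i ^ j) (MvPolynomial.pderiv (i, μ) f) := by
  induction j with
  | zero => simp [laplacian_X_mul]
  | succ j ih =>
    rw [pow_succ' _ (j + 1), Module.End.mul_apply, ih, map_add, laplacian_X_mul, map_smul,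
      ← Module.End.mul_apply, ← Module.End.mul_apply, ← pow_succ', ← pow_succ', add_assoc]
    congr 1
    have hc : ∀ m : ℕ, MvPolynomial.pderiv (i, μ) ((laplacian i ^ m) f) =
        (laplacian i ^ m) (MvPolynomial.pderiv (i, μ) f) := fun m => by
      induction m with
      | zero => rfl
      | succ m ihm =>
        rw [pow_succ', Module.End.mul_apply, Module.End.mul_apply, ← laplacian_pderiv, ihm]
    rw [hc, ← add_smul]
    congr 1
    push_cast
    ring

theorem laplacian_pow_X_mul_of_ne {p : ι × Fin 3} (hp : p.1 ≠ i) (f : VecPoly ι) (j : ℕ) :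
    (laplacian i ^ j) (MvPolynomial.X p * f) = MvPolynomial.X p * (laplacian i ^ j) f := by
  induction j with
  | zero => rfl
  | succ j ih =>
    rw [pow_succ', Module.End.mul_apply, ih, laplacian_X_mul_of_ne i hp, Module.End.mul_apply]

/-- The first `N` terms of `exp (c Δ) f`. -/
def heatSum (c : ℂ) (N : ℕ) : VecPoly ι →ₗ[ℂ] VecPoly ι :=
  ∑ j ∈ Finset.range N, (c ^ j / (j.factorial : ℂ)) • laplacian i ^ j

theorem heatSum_apply (c : ℂ) (N : ℕ) (f : VecPoly ι) : heatSum i c N f =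
    ∑ j ∈ Finset.range N, (c ^ j / (j.factorial : ℂ)) • (laplacian i ^ j) f := by
  simp [heatSum]

theorem heatSum_X_mul (c : ℂ) (N : ℕ) (μ : Fin 3) (f : VecPoly ι) :
    heatSum i c (N + 1) (MvPolynomial.X (i, μ) * f) =
      MvPolynomial.X (i, μ) * heatSum i c (N + 1) f +
        (2 * c) • heatSum i c N (MvPolynomial.pderiv (i, μ) f) := by
  have : ∀ j : ℕ, c ^ (j + 1) / ((j + 1).factorial : ℂ) * (2 * ((j : ℂ) + 1)) =
      2 * c * (c ^ j / (j.factorial : ℂ)) := fun j => by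
    have h1 := Nat.cast_add_one_ne_zero (R := ℂ) j
    have h2 : (j.factorial : ℂ) ≠ 0 := Nat.cast_ne_zero.2 j.factorial_ne_zero
    rw [Nat.factorial_succ]
    push_cast
    field_simp
    ring
  rw [heatSum_apply, heatSum_apply, heatSum_apply, Finset.sum_range_succ', Finset.sum_range_succ',
    mul_add, Finset.mul_sum, Finset.smul_sum]
  simp only [laplacian_pow_X_mul, smul_add, Finset.sum_add_distrib, smul_smul, this, mul_smul_comm,
    pow_zero, Module.End.one_apply]
  abel

/-- A linear functional on polynomials that satisfies the Schwinger-Dyson equations of the Gaussian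
in `a i` of variance `2 c` is the heat operator `exp (c Δ)` followed by evaluation at `a i = 0`. -/
theorem eq_heatSum_of_schwingerDyson [Fintype ι] (c : ℂ) (a : ι → Fin 3 → ℝ) (ha : a i = 0)
    (E : VecPoly ι →ₗ[ℂ] ℂ)
    (hX : ∀ μ f, E (MvPolynomial.X (i, μ) * f) = 2 * c * E (MvPolynomial.pderiv (i, μ) f))
    (hne : ∀ p : ι × Fin 3, p.1 ≠ i → ∀ f, E (MvPolynomial.X p * f) = a p.1 p.2 * E f)
    (f : VecPoly ι) {N : ℕ} (hN : f.totalDegree < N) :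
    E f = E 1 * VecPoly.evalAt a (heatSum i c N f) := by
  have key : ∀ d N, d < N → ∀ f : VecPoly ι, f.IsHomogeneous d →
      E f = E 1 * VecPoly.evalAt a (heatSum i c N f) := by
    intro d
    induction d using Nat.strong_induction_on with
    | _ d ih =>
      intro N hN f hf
      obtain ⟨N, rfl⟩ : ∃ M, N = M + 1 := ⟨N - 1, by omega⟩
      cases d with
      | zero =>
        have h : f.totalDegree = 0 := (MvPolynomial.totalDegree_zero_iff_isHomogeneous _).2 hf
        rw [MvPolynomial.totalDegree_eq_zero_iff_eq_C.1 h]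
        generalize MvPolynomial.coeff 0 f = x
        have hx : (MvPolynomial.C x : VecPoly ι) = x • 1 := by
          rw [MvPolynomial.smul_eq_C_mul, mul_one]
        have h0 : ∀ j, (laplacian i ^ (j + 1)) (1 : VecPoly ι) = 0 := fun j => by
          rw [pow_succ, Module.End.mul_apply, laplacian_apply]
          simp
        rw [hx, map_smul, map_smul, map_smul, heatSum_apply, Finset.sum_range_succ']
        simp [h0, mul_comm]
      | succ d =>
        have hXp : ∀ p, E (MvPolynomial.X p * MvPolynomial.pderiv p f) = E 1 *
            VecPoly.evalAt a
              (heatSum i c (N + 1) (MvPolynomial.X p * MvPolynomial.pderiv p f)) := by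
          intro p
          have hg : (MvPolynomial.pderiv p f).IsHomogeneous d := hf.pderiv
          generalize MvPolynomial.pderiv p f = g at hg
          obtain ⟨j, μ⟩ := p
          by_cases hj : j = i
          · subst hj
            rw [hX, heatSum_X_mul, ih (d - 1) (by omega) N (by omega) _ hg.pderiv]
            simp [VecPoly.evalAt, ha]
            ring
          · rw [hne _ hj, ih d (by omega) (N + 1) (by omega) _ hg]
            simp only [heatSum_apply, laplacian_pow_X_mul_of_ne i (p := (j, μ)) hj, map_sum,
              map_smul, map_mul, Finset.mul_sum]
            refine Finset.sum_congr rfl fun k _ => ?_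
            simp [VecPoly.evalAt]
            ring
        -- Euler's identity writes a homogeneous polynomial in terms of the `X p * ∂ₚ f`
        have he := hf.sum_X_mul_pderiv
        have hd : ((d + 1 : ℕ) : ℂ) ≠ 0 := Nat.cast_ne_zero.2 (by omega)
        have hsum : E (∑ p, MvPolynomial.X p * MvPolynomial.pderiv p f) = E 1 * VecPoly.evalAt a
            (heatSum i c (N + 1) (∑ p, MvPolynomial.X p * MvPolynomial.pderiv p f)) := by
          simp only [map_sum, hXp, Finset.mul_sum]
        rw [he, ← Nat.cast_smul_eq_nsmul ℂ, map_smul, map_smul, map_smul] at hsum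
        simp only [smul_eq_mul] at hsum
        refine mul_left_cancel₀ hd (hsum.trans (by ring))
  conv_lhs => rw [← MvPolynomial.sum_homogeneousComponent f]
  conv_rhs => rw [← MvPolynomial.sum_homogeneousComponent f]
  simp only [map_sum, Finset.mul_sum]
  refine Finset.sum_congr rfl fun d hd => ?_
  have := Finset.mem_range.1 hd
  exact key d N (by omega) _ (MvPolynomial.homogeneousComponent_isHomogeneous d f)

end HeatOperator

/-! ### Gaussian integrals of polynomials -/

section Gaussian

variable {n : ℕ}

theorem integrable_pow_mul_cexp_neg_mul_sq {z : ℂ} (hz : 0 < z.re) (m : ℕ) :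
    Integrable fun x : ℝ => Complex.exp (-z * (x : ℂ) ^ 2) * (x : ℂ) ^ m := by
  have h := integrable_rpow_mul_exp_neg_mul_sq hz (s := m)
    (lt_of_lt_of_le neg_one_lt_zero m.cast_nonneg)
  refine h.mono (by fun_prop) (Eventually.of_forall fun x => le_of_eq ?_)
  rw [norm_mul, norm_cexp_neg_mul_sq, norm_mul, Real.rpow_natCast, norm_pow, norm_pow,
    Complex.norm_real, Real.norm_of_nonneg (Real.exp_pos _).le, mul_comm]

theorem cexp_neg_mul_dotProduct (z : ℂ) (b : Fin 3 → ℝ) :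
    Complex.exp (-z * (dotProduct b b : ℝ)) = ∏ μ, Complex.exp (-z * (b μ : ℂ) ^ 2) := by
  rw [← Complex.exp_sum, dotProduct]
  push_cast
  rw [Finset.mul_sum]
  congr 1
  exact Finset.sum_congr rfl fun μ _ => by ring

theorem integrable_gaussian_mul_at {z : ℂ} (hz : 0 < z.re) (a : Fin n → Fin 3 → ℝ)
    (f : VecPoly (Fin (n + 1))) :
    Integrable fun b : Fin 3 → ℝ =>
      Complex.exp (-z * (dotProduct b b : ℝ)) * VecPoly.evalAt (Matrix.vecCons b a) f := by
  -- the additional monomial makes the induction on `f` go through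
  suffices h : ∀ m : Fin 3 → ℕ, Integrable fun b : Fin 3 → ℝ =>
      Complex.exp (-z * (dotProduct b b : ℝ)) * (∏ μ, (b μ : ℂ) ^ m μ) *
        VecPoly.evalAt (Matrix.vecCons b a) f by
    simpa using h 0
  induction f using MvPolynomial.induction_on with
  | C c =>
    intro m
    have h := Integrable.fintype_prod (𝕜 := ℂ) (μ := fun _ : Fin 3 => (volume : Measure ℝ))
      (f := fun μ (x : ℝ) => Complex.exp (-z * (x : ℂ) ^ 2) * (x : ℂ) ^ m μ)
      fun μ => integrable_pow_mul_cexp_neg_mul_sq hz (m μ)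
    simp only [cexp_neg_mul_dotProduct, ← Finset.prod_mul_distrib]
    simpa [VecPoly.evalAt, volume_pi] using h.mul_const c
  | add p q hp hq =>
    intro m
    simp only [map_add, mul_add]
    exact (hp m).add (hq m)
  | mul_X p x hp =>
    intro m
    obtain ⟨j, ν⟩ := x
    refine Fin.cases ?_ (fun j => ?_) j
    · convert hp (m + Pi.single ν 1) using 2 with b
      have h1 : ∏ μ, (b μ : ℂ) ^ (m + Pi.single ν 1 : Fin 3 → ℕ) μ =
          (∏ μ, (b μ : ℂ) ^ m μ) * b ν := by
        simp only [Pi.add_apply, pow_add, Finset.prod_mul_distrib]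
        congr 1
        rw [Finset.prod_eq_single ν (fun κ _ hκ => by simp [hκ]) (by simp)]
        simp
      rw [h1, map_mul]
      simp [VecPoly.evalAt]
      ring
    · convert (hp m).mul_const (a j ν : ℂ) using 2 with b
      simp [VecPoly.evalAt]
      ring

theorem integral_gaussian_three {z : ℂ} (hz : 0 < z.re) :
    ∫ b : Fin 3 → ℝ, Complex.exp (-z * (dotProduct b b : ℝ)) =
      ((Real.pi / z : ℂ) ^ (1 / 2 : ℂ)) ^ 3 := by
  simp only [cexp_neg_mul_dotProduct]
  rw [integral_fintype_prod_volume_eq_prod (fun _ (x : ℝ) => Complex.exp (-z * (x : ℂ) ^ 2))]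
  simp only [integral_gaussian_complex hz]
  simp

theorem hasDerivAt_evalAt_vecCons (a : Fin n → Fin 3 → ℝ) (b : Fin 3 → ℝ) (μ : Fin 3)
    (f : VecPoly (Fin (n + 1))) :
    HasDerivAt (fun t : ℝ => VecPoly.evalAt (Matrix.vecCons (b + t • Pi.single μ 1) a) f)
      (VecPoly.evalAt (Matrix.vecCons b a) (MvPolynomial.pderiv (0, μ) f)) 0 := by
  induction f using MvPolynomial.induction_on with
  | C c => simpa [VecPoly.evalAt] using hasDerivAt_const (0 : ℝ) c
  | add p q hp hq =>
    simp only [map_add]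
    exact hp.add hq
  | mul_X p x hp =>
    have hX : HasDerivAt (fun t : ℝ => VecPoly.evalAt
        (Matrix.vecCons (b + t • Pi.single μ 1) a) (MvPolynomial.X x : VecPoly (Fin (n + 1))))
        (VecPoly.evalAt (Matrix.vecCons b a)
          (MvPolynomial.pderiv (0, μ) (MvPolynomial.X x))) 0 := by
      obtain ⟨j, ν⟩ := x
      refine Fin.cases ?_ (fun j => ?_) j
      · have h : HasDerivAt (fun t : ℝ => ((b ν + t * (Pi.single μ 1 : Fin 3 → ℝ) ν : ℝ) : ℂ))
            (((1 : ℝ) * (Pi.single μ 1 : Fin 3 → ℝ) ν : ℝ) : ℂ) 0 :=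
          (((hasDerivAt_id (0 : ℝ)).mul_const _).const_add _).ofReal_comp
        convert h using 1
        · ext t
          simp [VecPoly.evalAt]
        · by_cases hν : ν = μ
          · subst hν; simp
          · rw [MvPolynomial.pderiv_X_of_ne (by simp [hν])]
            simp [hν]
      · rw [MvPolynomial.pderiv_X_of_ne (by simp), map_zero]
        simpa [VecPoly.evalAt] using hasDerivAt_const (0 : ℝ) ((a j ν : ℝ) : ℂ)
    simp only [MvPolynomial.pderiv_mul, map_mul, map_add]
    refine (hp.mul hX).congr_deriv ?_
    simp

/-- The square of the first vector. -/
def firstSq (n : ℕ) : VecPoly (Fin (n + 1)) := dotProduct (vecVar 0) (vecVar 0)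

theorem evalAt_firstSq (b : Fin 3 → ℝ) (a : Fin n → Fin 3 → ℝ) :
    VecPoly.evalAt (Matrix.vecCons b a) (firstSq n) = (dotProduct b b : ℝ) := by
  simp [firstSq, dotProduct, vecVar, VecPoly.evalAt]

theorem pderiv_firstSq (n : ℕ) (μ : Fin 3) :
    MvPolynomial.pderiv (0, μ) (firstSq n) = (2 : ℂ) • MvPolynomial.X (0, μ) := by
  simp only [firstSq, dotProduct, vecVar, map_sum]
  rw [Finset.sum_eq_single μ]
  · rw [MvPolynomial.pderiv_mul, MvPolynomial.pderiv_X_self, two_smul]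
    ring
  · intro ν _ hν
    rw [MvPolynomial.pderiv_mul, MvPolynomial.pderiv_X_of_ne (by simp [hν])]
    simp
  · simp

/-- The integral of a polynomial in the first vector against `exp (-z |b|²)`. -/
def gaussianFunctional {z : ℂ} (hz : 0 < z.re) (a : Fin n → Fin 3 → ℝ) :
    VecPoly (Fin (n + 1)) →ₗ[ℂ] ℂ where
  toFun f := ∫ b : Fin 3 → ℝ,
    Complex.exp (-z * (dotProduct b b : ℝ)) * VecPoly.evalAt (Matrix.vecCons b a) f
  map_add' f g := by
    simp only [map_add, mul_add]
    exact integral_add (integrable_gaussian_mul_at hz a f) (integrable_gaussian_mul_at hz a g)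
  map_smul' c f := by
    simp only [map_smul, smul_eq_mul, mul_left_comm _ c, RingHom.id_apply]
    exact integral_const_mul _ _

/-- Integration by parts against `exp (-z |b|²)`. -/
theorem gaussianFunctional_X_mul {z : ℂ} (hz : 0 < z.re) (a : Fin n → Fin 3 → ℝ) (μ : Fin 3)
    (f : VecPoly (Fin (n + 1))) :
    gaussianFunctional hz a (MvPolynomial.X (0, μ) * f) =
      2 * (1 / (4 * z)) * gaussianFunctional hz a (MvPolynomial.pderiv (0, μ) f) := by
  have hz0 : z ≠ 0 := fun h => by simp [h] at hz
  set g := MvPolynomial.pderiv (0, μ) f - (2 * z) • (MvPolynomial.X (0, μ) * f) with hg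
  have hd : ∀ b : Fin 3 → ℝ, HasLineDerivAt ℝ (fun b : Fin 3 → ℝ =>
      Complex.exp (-z * (dotProduct b b : ℝ)) * VecPoly.evalAt (Matrix.vecCons b a) f)
      (Complex.exp (-z * (dotProduct b b : ℝ)) * VecPoly.evalAt (Matrix.vecCons b a) g) b
      (Pi.single μ 1) := by
    intro b
    have h1 := ((hasDerivAt_evalAt_vecCons a b μ (firstSq n)).const_mul (-z)).cexp
    have h2 := h1.mul (hasDerivAt_evalAt_vecCons a b μ f)
    simp only [evalAt_firstSq] at h2
    refine h2.congr_deriv ?_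
    simp only [hg, pderiv_firstSq, map_sub, map_smul, map_mul, zero_smul, add_zero, smul_eq_mul]
    ring
  have h0 := integral_bilinear_hasLineDerivAt_right_eq_neg_left_of_integrable
    (μ := (volume : Measure (Fin 3 → ℝ))) (f := fun _ => (1 : ℂ)) (f' := fun _ => 0)
    (B := ContinuousLinearMap.mul ℝ ℂ) (by simp)
    (by simpa using integrable_gaussian_mul_at hz a g)
    (by simpa using integrable_gaussian_mul_at hz a f)
    (fun x _ => by simpa [HasLineDerivAt] using hasDerivAt_const (0 : ℝ) (1 : ℂ))
    (fun x _ => hd x)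
  have hE : gaussianFunctional hz a g = 0 := by
    simpa [gaussianFunctional] using h0
  rw [hg, map_sub, map_smul, sub_eq_zero] at hE
  rw [hE, smul_eq_mul]
  field_simp
  ring

theorem gaussianFunctional_eq {z : ℂ} (hz : 0 < z.re) (a : Fin n → Fin 3 → ℝ)
    (f : VecPoly (Fin (n + 1))) {N : ℕ} (hN : f.totalDegree < N) :
    gaussianFunctional hz a f = ((Real.pi / z : ℂ) ^ (1 / 2 : ℂ)) ^ 3 *
      VecPoly.evalAt (Matrix.vecCons 0 a) (heatSum 0 (1 / (4 * z)) N f) := by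
  have h1 : gaussianFunctional hz a 1 = ((Real.pi / z : ℂ) ^ (1 / 2 : ℂ)) ^ 3 := by
    rw [← integral_gaussian_three hz]
    simp [gaussianFunctional]
  rw [← h1]
  refine eq_heatSum_of_schwingerDyson 0 _ _ rfl _ (gaussianFunctional_X_mul hz a) ?_ f hN
  rintro ⟨j, ν⟩ hj f
  obtain ⟨j, rfl⟩ := Fin.exists_succ_eq.2 hj
  change ∫ b : Fin 3 → ℝ, _ = _ * ∫ b : Fin 3 → ℝ, _
  rw [← integral_const_mul]
  congr 1
  ext b
  simp [VecPoly.evalAt]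
  ring

/-- The oscillatory integral of `exp (i α |b|²)` times a polynomial. Any `N` above the degree of `f`
gives the full exponential of the Laplacian. -/
theorem hasOscillatoryIntegral_gaussian {α : ℝ} (hα : α ≠ 0) (a : Fin n → Fin 3 → ℝ)
    (f : VecPoly (Fin (n + 1))) {N : ℕ} (hN : f.totalDegree < N) :
    HasOscillatoryIntegral
      (fun b => Complex.exp (Complex.I * α * (dotProduct b b : ℝ)) *
        VecPoly.evalAt (Matrix.vecCons b a) f)
      (((Real.pi / (-(Complex.I * α)) : ℂ) ^ (1 / 2 : ℂ)) ^ 3 *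
        VecPoly.evalAt (Matrix.vecCons 0 a) (heatSum 0 (1 / (4 * -(Complex.I * α))) N f)) := by
  have hre : ∀ ε : ℝ, ((ε : ℂ) - Complex.I * α).re = ε := fun ε => by simp
  have hfun : ∀ ε : ℝ, (fun b : Fin 3 → ℝ => (Real.exp (-ε * dotProduct b b) : ℂ) *
      (Complex.exp (Complex.I * α * (dotProduct b b : ℝ)) *
        VecPoly.evalAt (Matrix.vecCons b a) f)) = fun b : Fin 3 → ℝ =>
      Complex.exp (-((ε : ℂ) - Complex.I * α) * (dotProduct b b : ℝ)) *
        VecPoly.evalAt (Matrix.vecCons b a) f := fun ε => by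
    ext b
    rw [← mul_assoc, Complex.ofReal_exp, ← Complex.exp_add]
    congr 2
    push_cast
    ring
  refine ⟨fun ε hε => ?_, ?_⟩
  · rw [hfun]
    exact integrable_gaussian_mul_at (by rwa [hre]) a f
  · have hev : (fun ε : ℝ => ∫ b : Fin 3 → ℝ, (Real.exp (-ε * dotProduct b b) : ℂ) *
        (Complex.exp (Complex.I * α * (dotProduct b b : ℝ)) *
          VecPoly.evalAt (Matrix.vecCons b a) f)) =ᶠ[𝓝[>] 0] fun ε : ℝ =>
        ((Real.pi / ((ε : ℂ) - Complex.I * α) : ℂ) ^ (1 / 2 : ℂ)) ^ 3 *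
          VecPoly.evalAt (Matrix.vecCons 0 a)
            (heatSum 0 (1 / (4 * ((ε : ℂ) - Complex.I * α))) N f) := by
      filter_upwards [self_mem_nhdsWithin] with ε hε
      rw [hfun]
      exact gaussianFunctional_eq (by rwa [hre]) a f hN
    refine Tendsto.congr' hev.symm ?_
    have hc0 : (0 : ℂ) - Complex.I * α ≠ 0 := by simpa using hα
    have hslit : (Real.pi / ((0 : ℂ) - Complex.I * α) : ℂ) ∈ Complex.slitPlane := by
      right
      have e : (Real.pi / ((0 : ℂ) - Complex.I * α) : ℂ) = ((Real.pi / α : ℝ) : ℂ) * Complex.I := by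
        have : (α : ℂ) ≠ 0 := by exact_mod_cast hα
        push_cast
        field_simp
        linear_combination (α : ℂ) * Complex.I_sq
      rw [e]
      simp [Real.pi_ne_zero, hα]
    have hcont : ContinuousAt (fun w : ℂ =>
        ((Real.pi / (w - Complex.I * α) : ℂ) ^ (1 / 2 : ℂ)) ^ 3 *
          VecPoly.evalAt (Matrix.vecCons 0 a)
            (heatSum 0 (1 / (4 * (w - Complex.I * α))) N f)) 0 := by
      simp only [heatSum_apply, map_sum, map_smul, smul_eq_mul]
      have hw : ContinuousAt (fun w : ℂ => w - Complex.I * α) 0 := by fun_prop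
      have h1 : ContinuousAt (fun w : ℂ => (Real.pi / (w - Complex.I * α) : ℂ)) 0 :=
        continuousAt_const.div hw hc0
      have h2 : ContinuousAt (fun w : ℂ => 1 / (4 * (w - Complex.I * α))) 0 :=
        continuousAt_const.div (continuousAt_const.mul hw) (mul_ne_zero (by norm_num) hc0)
      refine ((h1.cpow continuousAt_const hslit).pow 3).mul ?_
      refine tendsto_finsetSum _ fun j _ => ?_
      exact ((h2.pow j).div_const _).mul_const _
    have hlim := (hcont.tendsto.comp (Complex.continuous_ofReal.tendsto' (0 : ℝ) 0 rfl)).mono_left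
      (nhdsWithin_le_nhds (s := Set.Ioi (0 : ℝ)))
    simpa only [zero_sub, Function.comp_def] using hlim

end Gaussian

/-! ### The factor `sin (π|v|) / (π|v|)` as an exponential -/

theorem PowerSeries.expOf_subst {f a : PowerSeries ℂ} (hf : constantCoeff f = 0)
    (ha : HasSubst a) : (expOf f).subst a = expOf (f.subst a) :=
  subst_comp_subst_apply (HasSubst.of_constantCoeff_zero' hf) ha _

/-- The coefficients `c r` of `|v| ^ (2 r) t ^ (2 r)` in `log (sin (π|v|) / (π|v|))`. -/
theorem exists_sincFactor_eq_expOf : ∃ c : ℕ → ℂ, c 0 = 0 ∧ ∀ v : Fin 3 → ℝ,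
    sincFactor v = PowerSeries.expOf (PowerSeries.mk fun k =>
      if Even k then c (k / 2) * ((dotProduct v v : ℝ) : ℂ) ^ (k / 2) else 0) := by
  -- work in one variable and substitute `|v|² t²` for it
  obtain ⟨f, hf0, hf⟩ := PowerSeries.exists_expOf_eq (g := PowerSeries.mk fun r =>
    (((-1) ^ r * (Real.pi ^ 2) ^ r / ((2 * r + 1).factorial : ℝ) : ℝ) : ℂ)) (by simp)
  refine ⟨fun r => PowerSeries.coeff r f, by simpa using hf0, fun v => ?_⟩
  set x : ℂ := ((dotProduct v v : ℝ) : ℂ) with hx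
  have hr0 : PowerSeries.constantCoeff (PowerSeries.rescale x f) = 0 := by
    rw [← PowerSeries.coeff_zero_eq_constantCoeff_apply] at hf0 ⊢
    simp [hf0]
  have h1 : PowerSeries.expand 2 two_ne_zero (PowerSeries.rescale x (PowerSeries.expOf f)) =
      PowerSeries.expOf (PowerSeries.expand 2 two_ne_zero (PowerSeries.rescale x f)) := by
    rw [PowerSeries.rescale_eq_subst, PowerSeries.expOf_subst hf0 (PowerSeries.HasSubst.smul_X' x),
      ← PowerSeries.rescale_eq_subst, PowerSeries.expand_apply, PowerSeries.expand_apply,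
      PowerSeries.expOf_subst hr0 (PowerSeries.HasSubst.X_pow two_ne_zero)]
  have h2 : sincFactor v =
      PowerSeries.expand 2 two_ne_zero (PowerSeries.rescale x (PowerSeries.expOf f)) := by
    ext k
    rw [hf, PowerSeries.coeff_expand, sincFactor, PowerSeries.coeff_mk]
    simp only [← even_iff_two_dvd]
    split_ifs with hk
    · obtain ⟨r, rfl⟩ := hk
      rw [← two_mul, Nat.mul_div_cancel_left _ two_pos, PowerSeries.coeff_rescale,
        PowerSeries.coeff_mk, hx, mul_pow]
      push_cast
      ring
    · rfl
  rw [h2, h1]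
  congr 1
  ext k
  rw [PowerSeries.coeff_expand, PowerSeries.coeff_mk]
  simp only [← even_iff_two_dvd]
  split_ifs with hk
  · rw [PowerSeries.coeff_rescale, mul_comm]
  · rfl

theorem isInvariantForm_firstSq_pow (n r : ℕ) : IsInvariantForm (2 * r) (firstSq n ^ r) := by
  have h : IsInvariantForm 2 (firstSq n) := IsTreePolynomial.isInvariantForm
    (Submodule.subset_span ⟨LegTree.leg 0, LegTree.leg 0, rfl, rfl⟩)
  refine ⟨h.1.pow r, fun U hU a b hab => ?_⟩
  have := h.2 U hU a b hab
  simp only [← VecPoly.evalAt_apply, map_pow] at this ⊢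
  rw [this]

/-- The factor `sin (π|a_1|) / (π|a_1|)` of the integrand is absorbed in the exponent. -/
theorem exists_integrand_eq_formalExp {n : ℕ} (L : ℕ → VecPoly (Fin (n + 1)))
    (P : ℕ → ℕ → VecPoly (Fin (n + 1))) (hP : ∀ m r, IsInvariantForm m (P m r)) :
    ∃ P₁ : ℕ → ℕ → VecPoly (Fin (n + 1)), (∀ m r, IsInvariantForm m (P₁ m r)) ∧
      ∀ K a, integrand L P K a = formalExp (exponent L P₁ K a) := by
  obtain ⟨c, hc0, hc⟩ := exists_sincFactor_eq_expOf
  refine ⟨fun m r => P m r + if Even m ∧ r = 0 then c (m / 2) • firstSq n ^ (m / 2) else 0,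
    fun m r => ?_, fun K a => ?_⟩
  · refine (invariantForms _ m).add_mem (hP m r) ?_
    split_ifs with h
    · refine (invariantForms _ m).smul_mem _ ?_
      have := isInvariantForm_firstSq_pow n (m / 2)
      rwa [Nat.two_mul_div_two_of_even h.1] at this
    · exact (invariantForms _ m).zero_mem
  · rw [integrand, hc, ← formalExp_of_constantCoeff_eq_zero, ← formalExp_add, add_comm]
    · congr 1
      ext k
      simp only [exponent, map_add, PowerSeries.coeff_mk, ← VecPoly.evalAt_apply, add_mul,
        Finset.sum_add_distrib, ← add_assoc]
      congr 1
      rw [Finset.sum_eq_single 0]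
      · have h : VecPoly.evalAt a (firstSq n) = (dotProduct (a 0) (a 0) : ℝ) := by
          simp [firstSq, dotProduct, vecVar, VecPoly.evalAt]
        by_cases hk : Even k <;> simp [hk, h]
      · intro r _ hr
        simp [hr]
      · simp
    · rw [← PowerSeries.coeff_zero_eq_constantCoeff_apply]
      simp [hc0]

/-! ### Completing the square -/

section Square

variable {n : ℕ} (l : Matrix (Fin (n + 1)) (Fin (n + 1)) ℝ)

/-- The matrix of the substitution `a_1 ↦ a_1 - (1 / l₁₁) ∑_{j ≥ 2} l_{1j} a_j`. -/
def shiftMatrix : Fin (n + 1) → Fin (n + 1) → ℝ :=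
  Fin.cons (Fin.cons 1 fun j => -(1 / l 0 0) * l 0 j.succ) fun j => Pi.single j.succ 1

theorem at_linearSubst_shiftMatrix (Q : VecPoly (Fin (n + 1))) (b : Fin 3 → ℝ)
    (a : Fin n → Fin 3 → ℝ) : (linearSubst (shiftMatrix l) Q).at (Matrix.vecCons b a) =
      Q.at (Matrix.vecCons (stationaryPoint l a + b) a) := by
  rw [at_linearSubst]
  congr 1
  ext1 i
  refine Fin.cases ?_ (fun j => ?_) i
  · simp [shiftMatrix, Fin.sum_univ_succ, stationaryPoint, Finset.smul_sum, smul_smul, add_comm]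
  · rw [Finset.sum_eq_single j.succ] <;> simp +contextual [shiftMatrix]

theorem at_linkingForm {ι : Type} [Fintype ι] (l : Matrix ι ι ℝ) (a : ι → Fin 3 → ℝ) :
    (linkingForm l).at a = ((∑ i, ∑ j, l i j * dotProduct (a i) (a j) : ℝ) : ℂ) := by
  rw [← VecPoly.evalAt_apply]
  simp [linkingForm, VecPoly.evalAt, dotProduct, vecVar]

theorem at_linkingForm_vecCons (hl : l.IsSymm) (h11 : l 0 0 ≠ 0) (b : Fin 3 → ℝ)
    (a : Fin n → Fin 3 → ℝ) :
    (linkingForm l).at (Matrix.vecCons (stationaryPoint l a + b) a) =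
      (linkingForm (reducedLinking l)).at a + ((l 0 0 * dotProduct b b : ℝ) : ℂ) := by
  rw [at_linkingForm, at_linkingForm, ← Complex.ofReal_add]
  congr 1
  set u : Fin 3 → ℝ := ∑ j : Fin n, l 0 j.succ • a j with hu
  have hv : stationaryPoint l a = -(1 / l 0 0) • u := rfl
  have h1 : ∀ w, ∑ j : Fin n, l 0 j.succ * dotProduct w (a j) = dotProduct w u := fun w => by
    simp [hu, dotProduct_sum]
  have h2 : ∀ w, ∑ j : Fin n, l j.succ 0 * dotProduct (a j) w = dotProduct w u := fun w => by
    rw [← h1]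
    refine Finset.sum_congr rfl fun j _ => ?_
    rw [hl.apply 0 j.succ, dotProduct_comm]
  have h3 : ∑ i : Fin n, ∑ j : Fin n, l 0 i.succ * l 0 j.succ / l 0 0 * dotProduct (a i) (a j) =
      dotProduct u u / l 0 0 := by
    rw [← h2 u, Finset.sum_div]
    refine Finset.sum_congr rfl fun i _ => ?_
    rw [← h1, hl.apply 0 i.succ, Finset.mul_sum, Finset.sum_div]
    exact Finset.sum_congr rfl fun j _ => by ring
  simp only [Fin.sum_univ_succ, Matrix.cons_val_zero, Matrix.cons_val_succ, reducedLinking,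
    Matrix.of_apply, sub_mul, Finset.sum_sub_distrib, h3, Finset.sum_add_distrib, h1, h2]
  rw [hv]
  simp only [add_dotProduct, dotProduct_add, smul_dotProduct, dotProduct_smul, smul_eq_mul,
    dotProduct_comm b u]
  field_simp
  ring

end Square

/-! ### The Gaussian prefactor -/

/-- The framing phase cancels the phase of the oscillatory Gaussian; `|x| ^ (-3/2)` remains. -/
theorem gaussian_prefactor {x K : ℝ} (hx : x ≠ 0) (hK : 0 < K) :
    Complex.exp (-(3 / 4) * Complex.I * (Real.pi : ℂ) * (Real.sign x : ℂ)) *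
        (((K / 2) ^ (3 / 2 : ℝ) : ℝ) : ℂ) *
        ((Real.pi / (-(Complex.I * (Real.pi * K * x / 2 : ℝ))) : ℂ) ^ (1 / 2 : ℂ)) ^ 3 =
      Complex.exp (-(3 / 2) * (Real.log |x| : ℝ)) := by
  set s : ℝ := Real.sign x with hs
  have hsx : s * |x| = x := by
    rcases lt_or_gt_of_ne hx with h | h
    · rw [hs, Real.sign_of_neg h, abs_of_neg h]; ring
    · rw [hs, Real.sign_of_pos h, abs_of_pos h]; ring
  have hs2 : s = 1 ∨ s = -1 := by
    rcases lt_or_gt_of_ne hx with h | h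
    · exact Or.inr (Real.sign_of_neg h)
    · exact Or.inl (Real.sign_of_pos h)
  have hI : Complex.exp (Complex.I * (Real.pi / 2) * s) = Complex.I * s := by
    rcases hs2 with h | h <;> rw [h]
    · simpa [mul_comm] using Complex.exp_pi_div_two_mul_I
    · have := Complex.exp_neg_pi_div_two_mul_I
      convert this using 2 <;> push_cast <;> ring
  have hax : 0 < |x| := abs_pos.2 hx
  set y : ℝ := Real.log (2 / (K * |x|)) with hy
  have hw : (Real.pi / (-(Complex.I * (Real.pi * K * x / 2 : ℝ))) : ℂ) =
      Complex.exp (y + Complex.I * (Real.pi / 2) * s) := by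
    rw [Complex.exp_add, hI, ← Complex.ofReal_exp, hy, Real.exp_log (by positivity)]
    have h1 : ((|x| : ℝ) : ℂ) ≠ 0 := by exact_mod_cast hax.ne'
    have h2 : (K : ℂ) ≠ 0 := by exact_mod_cast hK.ne'
    have h3 : (Real.pi : ℂ) ≠ 0 := by exact_mod_cast Real.pi_ne_zero
    have h4 : (x : ℂ) = s * (|x| : ℝ) := by exact_mod_cast hsx.symm
    have h5 : (s : ℂ) * s = 1 := by rcases hs2 with h | h <;> simp [h]
    have h6 : (s : ℂ) ≠ 0 := left_ne_zero_of_mul_eq_one h5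
    push_cast
    rw [h4]
    field_simp
    linear_combination (-(s : ℂ) * s) * Complex.I_sq + h5
  have hlog : Complex.log (Complex.exp (y + Complex.I * (Real.pi / 2) * s)) =
      y + Complex.I * (Real.pi / 2) * s := by
    have him : ((y : ℂ) + Complex.I * (Real.pi / 2) * s).im = Real.pi / 2 * s := by
      have e : ((y : ℂ) + Complex.I * (Real.pi / 2) * s) =
        (y : ℂ) + ((Real.pi / 2 * s : ℝ) : ℂ) * Complex.I := by push_cast; ring
      rw [e, Complex.add_im, Complex.ofReal_im, Complex.im_ofReal_mul, Complex.I_im,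
        mul_one, zero_add]
    refine Complex.log_exp ?_ ?_ <;> rw [him] <;> rcases hs2 with h | h <;> rw [h] <;>
      linarith [Real.pi_pos]
  rw [hw, Complex.cpow_def_of_ne_zero (Complex.exp_ne_zero _), hlog, ← Complex.exp_nat_mul,
    Real.rpow_def_of_pos (by positivity), Complex.ofReal_exp, ← Complex.exp_add, ← Complex.exp_add]
  have hly : y = -Real.log (K / 2) - Real.log |x| := by
    rw [hy, Real.log_div two_ne_zero (by positivity), Real.log_mul hK.ne' hax.ne',
      Real.log_div hK.ne' two_ne_zero]
    ring
  congr 1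
  rw [hly]
  push_cast
  ring

/-! ### The integral of the exponential of a flow -/

theorem expansionTerms_mono {ι : Type} {j j' k : ℕ} (h : j ≤ j') :
    expansionTerms ι j' k ≤ expansionTerms ι j k := by
  refine Submodule.span_mono ?_
  rintro _ (⟨hk, T, hT, rfl⟩ | ⟨d, l, Q, hd, hk, hQ, rfl⟩)
  · exact Or.inl ⟨by omega, T, hT, rfl⟩
  · exact Or.inr ⟨d, l, Q, hd, by omega, hQ, rfl⟩

section FlowIntegral

variable {n : ℕ} {V : ℕ → ℂ → VecPoly (Fin (n + 1))}

/-- Evaluation of `A[s]`, `A` the polynomials in the vectors, at a value of `s` and at vectors. -/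
def evalTime (s : ℂ) (a : Fin n → Fin 3 → ℝ) (b : Fin 3 → ℝ) :
    Polynomial (VecPoly (Fin (n + 1))) →+* ℂ :=
  Polynomial.eval₂RingHom (VecPoly.evalAt (Matrix.vecCons b a)).toRingHom s

theorem evalTime_apply (s : ℂ) (a : Fin n → Fin 3 → ℝ) (b : Fin 3 → ℝ)
    (g : Polynomial (VecPoly (Fin (n + 1)))) {N : ℕ} (hN : g.natDegree < N) :
    evalTime s a b g =
      ∑ j ∈ Finset.range N, VecPoly.evalAt (Matrix.vecCons b a) (g.coeff j) * s ^ j :=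
  Polynomial.eval₂_eq_sum_range' _ hN _

theorem evalTime_zero (a : Fin n → Fin 3 → ℝ) (b : Fin 3 → ℝ)
    (g : Polynomial (VecPoly (Fin (n + 1)))) :
    evalTime 0 a b g = VecPoly.evalAt (Matrix.vecCons b a) (g.coeff 0) :=
  Polynomial.eval₂_at_zero _

/-- The heat equation in `s` determines all coefficients from the one at `s = 0`. -/
theorem laplacian_pow_coeff_expOf (hV : ∀ k, V k ∈ expansionTerms _ 0 k) (hV0 : V 0 = 0) {K : ℂ}
    (hK : K ≠ 0) (k j : ℕ) :
    (laplacian 0 ^ j) ((PowerSeries.coeff k (PowerSeries.expOf (flowSeries 0 V K))).coeff 0) =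
      (K ^ j * (j.factorial : ℂ)) •
        (PowerSeries.coeff k (PowerSeries.expOf (flowSeries 0 V K))).coeff j := by
  induction j with
  | zero => simp
  | succ j ih =>
    have h := congrArg (fun F => (PowerSeries.coeff k F).coeff j)
      (seriesDerivS_expOf 0 hV hV0 hK)
    have hc : ∀ F : PowerSeries (Polynomial (VecPoly (Fin (n + 1)))),
        (PowerSeries.coeff k ((K⁻¹ : ℂ) • F)).coeff j =
          (K⁻¹ : ℂ) • (PowerSeries.coeff k F).coeff j := fun F => rfl
    simp only [coeff_seriesDerivS, hc, map_sum, Polynomial.finsetSum_coeff,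
      coeff_seriesPDeriv] at h
    rw [← laplacian_apply, eq_inv_smul_iff₀ hK] at h
    rw [pow_succ', Module.End.mul_apply, ih, map_smul, ← h, smul_smul, smul_smul,
      Nat.factorial_succ]
    congr 1
    push_cast
    ring

/-- Integrating the exponential of the flow at `s = 0` over the first vector, with the weight
`exp ((iπK/2) x |b|²)`, sets this vector to `0` and `s` to `i / (2 π x)`. -/
theorem hasOscillatoryIntegral_expOf_flowSeries (hV : ∀ k, V k ∈ expansionTerms _ 0 k)
    (hV0 : V 0 = 0) {K x : ℝ} (hK : 0 < K) (hx : x ≠ 0) (a : Fin n → Fin 3 → ℝ) (y : ℂ) (k : ℕ) :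
    HasOscillatoryIntegral
      (fun b => Complex.exp (y + Complex.I * (Real.pi * K * x / 2 : ℝ) * (dotProduct b b : ℝ)) *
        PowerSeries.coeff k (PowerSeries.expOf (PowerSeries.map (evalTime 0 a b)
          (flowSeries 0 V K))))
      (Complex.exp y *
        ((Real.pi / (-(Complex.I * (Real.pi * K * x / 2 : ℝ))) : ℂ) ^ (1 / 2 : ℂ)) ^ 3 *
        PowerSeries.coeff k (PowerSeries.expOf (PowerSeries.map
          (evalTime (Complex.I / (2 * Real.pi * x)) a 0) (flowSeries 0 V K)))) := by
  have hK' : (K : ℂ) ≠ 0 := by exact_mod_cast hK.ne'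
  have hπ : (Real.pi : ℂ) ≠ 0 := by exact_mod_cast Real.pi_ne_zero
  have hx' : (x : ℂ) ≠ 0 := by exact_mod_cast hx
  have h0 := constantCoeff_flowSeries (0 : Fin (n + 1)) hV0 (K : ℂ)
  set G := PowerSeries.coeff k (PowerSeries.expOf (flowSeries 0 V (K : ℂ))) with hG
  -- `N` exceeds the degree in the vectors and the degree in `s`, so that no term is cut off
  set N := max (Polynomial.natDegree G)
    (MvPolynomial.totalDegree (Complex.exp y • G.coeff 0)) + 1 with hN
  have hα : Real.pi * K * x / 2 ≠ 0 := by
    have := Real.pi_ne_zero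
    have := hK.ne'
    positivity
  have h := hasOscillatoryIntegral_gaussian hα a (Complex.exp y • G.coeff 0) (N := N)
    (Nat.lt_succ_of_le (le_max_right _ _))
  convert h using 1
  · ext b
    rw [← PowerSeries.map_expOf _ h0, PowerSeries.coeff_map, ← hG, evalTime_zero, Complex.exp_add,
      map_smul, smul_eq_mul]
    ring
  · rw [← PowerSeries.map_expOf _ h0, PowerSeries.coeff_map, ← hG,
      evalTime_apply _ a 0 G (Nat.lt_succ_of_le (le_max_left _ _)), map_smul, map_smul, smul_eq_mul,
      heatSum_apply, map_sum, mul_comm (Complex.exp y), mul_assoc]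
    congr 2
    refine Finset.sum_congr rfl fun j _ => ?_
    rw [hG, laplacian_pow_coeff_expOf hV hV0 hK', map_smul, map_smul, smul_eq_mul, smul_eq_mul,
      ← mul_assoc, mul_comm]
    congr 1
    have hj : (j.factorial : ℂ) ≠ 0 := Nat.cast_ne_zero.2 j.factorial_ne_zero
    -- the variance of the Gaussian in units of `K⁻¹` does not depend on `K`
    have hs : Complex.I / (2 * Real.pi * x) =
        1 / (4 * -(Complex.I * (Real.pi * K * x / 2 : ℝ))) * K := by
      push_cast
      have hI := Complex.I_ne_zero
      field_simp
      linear_combination 4 * Complex.I_sq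
    rw [hs, mul_pow]
    field_simp

end FlowIntegral

/-! ### The effective exponent -/

section EffectiveExponent

variable {n : ℕ} (l : Matrix (Fin (n + 1)) (Fin (n + 1)) ℝ) (L : ℕ → VecPoly (Fin (n + 1)))
  (P : ℕ → ℕ → VecPoly (Fin (n + 1)))

/-- The coefficient of `t ^ k`, `k ≥ 1`, in `h = K⁻¹` times the exponent shifted to the stationary
point, as a function of `h`. The coefficient of `t ^ 0` is left out: it depends on `a_1` only
through the Gaussian. -/
def shiftedExponent (k : ℕ) : ℂ → VecPoly (Fin (n + 1)) :=
  if k = 0 then 0 else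
    (fun _ => linearSubst (shiftMatrix l) ((Complex.I * Real.pi / 2) • L (k + 2))) +
      ∑ r ∈ Finset.range (k / 2 + 1),
        fun h => h ^ (r + 1) • linearSubst (shiftMatrix l) (P (k - 2 * r) r)

theorem shiftedExponent_zero : shiftedExponent l L P 0 = 0 := if_pos rfl

variable {L P}

theorem shiftedExponent_mem_expansionTerms (hL : ∀ m, 2 ≤ m → IsTreePolynomial m (L m))
    (hP : ∀ m r, IsInvariantForm m (P m r)) (k : ℕ) :
    shiftedExponent l L P k ∈ expansionTerms _ 0 k := by
  by_cases hk : k = 0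
  · rw [shiftedExponent, if_pos hk]
    exact Submodule.zero_mem _
  · rw [shiftedExponent, if_neg hk]
    refine Submodule.add_mem _ (const_mem_expansionTerms (by omega) ?_)
      (Submodule.sum_mem _ fun r hr => ?_)
    · exact isTreePolynomial_linearSubst _ (Submodule.smul_mem _ _ (hL _ (by omega)))
    · have := Finset.mem_range.1 hr
      exact pow_smul_mem_expansionTerms r (by omega) (by omega)
        (isInvariantForm_linearSubst _ (hP _ r))

variable {l}

theorem exponent_eq_add_map_flowSeries (hl : l.IsSymm) (h11 : l 0 0 ≠ 0)
    (hL2 : L 2 = linkingForm l) (hL : ∀ m, 2 ≤ m → IsTreePolynomial m (L m))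
    (hP : ∀ m r, IsInvariantForm m (P m r)) {K : ℝ} (hK : 0 < K) (a : Fin n → Fin 3 → ℝ)
    (b : Fin 3 → ℝ) :
    exponent L P K (Matrix.vecCons (stationaryPoint l a + b) a) =
      PowerSeries.C (Complex.I * Real.pi * K / 2 * (linkingForm (reducedLinking l)).at a +
          MvPolynomial.coeff 0 (P 0 0) +
          Complex.I * (Real.pi * K * l 0 0 / 2 : ℝ) * (dotProduct b b : ℝ)) +
        PowerSeries.map (evalTime 0 a b) (flowSeries 0 (shiftedExponent l L P) K) := by
  have hK' : (K : ℂ) ≠ 0 := by exact_mod_cast hK.ne'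
  ext k
  rw [map_add, PowerSeries.coeff_map, evalTime_zero,
    coeff_flowSeries 0 (shiftedExponent_mem_expansionTerms l hL hP), flow, exponent,
    PowerSeries.coeff_mk, PowerSeries.coeff_C]
  by_cases hk : k = 0
  · subst hk
    have hP00 : ∀ a, (P 0 0).at a = MvPolynomial.coeff 0 (P 0 0) := fun a => by
      have h := (MvPolynomial.totalDegree_zero_iff_isHomogeneous _).2 (hP 0 0).1
      conv_lhs => rw [MvPolynomial.totalDegree_eq_zero_iff_eq_C.1 h]
      simp [VecPoly.at]
    rw [shiftedExponent_zero]
    simp only [if_pos, zero_add, hL2, at_linkingForm_vecCons l hl h11]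
    simp [hP00]
    ring
  · simp only [shiftedExponent, if_neg hk, zero_add, Pi.add_apply, Finset.sum_apply, smul_add,
      map_add, Finset.smul_sum, map_sum, map_smul, VecPoly.evalAt_apply,
      at_linearSubst_shiftMatrix, smul_eq_mul]
    congr 1
    · ring
    · refine Finset.sum_congr rfl fun r _ => ?_
      rw [pow_succ', ← mul_assoc, ← mul_assoc, mul_inv_cancel₀ hK', one_mul, mul_comm]

/-- The substitution `a_1 = 0`. -/
def setFirstZero (n : ℕ) : VecPoly (Fin (n + 1)) →ₐ[ℂ] VecPoly (Fin n) :=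
  linearSubst (Fin.cons 0 fun j => Pi.single j 1)

theorem at_setFirstZero (F : VecPoly (Fin (n + 1))) (a : Fin n → Fin 3 → ℝ) :
    (setFirstZero n F).at a = F.at (Matrix.vecCons 0 a) := by
  rw [setFirstZero, at_linearSubst]
  congr 1
  ext1 i
  refine Fin.cases ?_ (fun j => ?_) i
  · simp
  · rw [Finset.sum_eq_single j] <;> simp +contextual

/-- The solution of the flow at time `s` and `a_1 = 0` is again the sum of `K` times tree
polynomials and of nonpositive powers of `K` times invariant forms, with coefficients that
do not depend on `K`. -/
theorem exists_map_flowSeries_eq {V : ℕ → ℂ → VecPoly (Fin (n + 1))}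
    (hV : ∀ k, V k ∈ expansionTerms _ 0 k) (s : ℂ) :
    ∃ (T : ℕ → VecPoly (Fin n)) (Q : ℕ → ℕ → VecPoly (Fin n)),
      (∀ k, IsTreePolynomial (k + 2) (T k)) ∧
      (∀ k r, 2 * r ≤ k → IsInvariantForm (k - 2 * r) (Q k r)) ∧
      ∀ K : ℝ, 0 < K → ∀ (a : Fin n → Fin 3 → ℝ) k,
        PowerSeries.coeff k (PowerSeries.map (evalTime s a 0) (flowSeries 0 V K)) =
          K * (T k).at a + ∑ r ∈ Finset.range (k / 2 + 1), (Q k r).at a * (K : ℂ)⁻¹ ^ r := by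
  have hW : ∀ k, ∑ j ∈ Finset.range (2 * k + 1), s ^ j • flow 0 V j k ∈ expansionTerms _ 0 k :=
    fun k => Submodule.sum_mem _ fun j _ => Submodule.smul_mem _ _
      (expansionTerms_mono (Nat.zero_le j) (flow_mem_expansionTerms 0 hV j k))
  choose T Q hT hQ hTQ using fun k => exists_eq_of_mem_expansionTerms (hW k)
  refine ⟨fun k => setFirstZero n (T k), fun k r => setFirstZero n (Q k r),
    fun k => isTreePolynomial_linearSubst _ (hT k),
    fun k r hr => isInvariantForm_linearSubst _ (hQ k r hr), fun K hK a k => ?_⟩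
  have hK' : (K : ℂ) ≠ 0 := by exact_mod_cast hK.ne'
  have h := congrArg (fun F => K * VecPoly.evalAt (Matrix.vecCons 0 a) F) (hTQ k (K : ℂ)⁻¹)
  simp only [Finset.sum_apply, Pi.smul_apply, map_add, map_sum, map_smul, mul_add, Finset.mul_sum,
    smul_eq_mul, VecPoly.evalAt_apply, ← at_setFirstZero] at h
  rw [PowerSeries.coeff_map, flowSeries, PowerSeries.coeff_mk, map_sum]
  refine Eq.trans (Finset.sum_congr rfl fun j _ => ?_) (h.trans ?_)
  · rw [evalTime, Polynomial.coe_eval₂RingHom, Polynomial.eval₂_monomial]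
    change VecPoly.evalAt _ ((K : ℂ) • _) * _ = _
    rw [map_smul, VecPoly.evalAt_apply, at_setFirstZero, smul_eq_mul]
    ring
  · congr 1
    refine Finset.sum_congr rfl fun r _ => ?_
    rw [pow_succ', ← mul_assoc, ← mul_assoc, mul_inv_cancel₀ hK', one_mul, mul_comm]

end EffectiveExponent

theorem isTreePolynomial_linkingForm {ι : Type} [Fintype ι] (l : Matrix ι ι ℝ) :
    IsTreePolynomial 2 (linkingForm l) := by
  refine Submodule.sum_mem _ fun i _ => Submodule.sum_mem _ fun j _ => ?_
  rw [← MvPolynomial.smul_eq_C_mul]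
  exact Submodule.smul_mem _ _ (Submodule.subset_span ⟨LegTree.leg i, LegTree.leg j, rfl, rfl⟩)

end

theorem lemma3p1 (n : ℕ) (l : Matrix (Fin (n + 1)) (Fin (n + 1)) ℝ) (hl : l.IsSymm)
    (h11 : l 0 0 ≠ 0)
    (L : ℕ → VecPoly (Fin (n + 1))) (P : ℕ → ℕ → VecPoly (Fin (n + 1)))
    (hL : ∀ m, 2 ≤ m → IsInvariantForm m (L m))
    (hP : ∀ m r, IsInvariantForm m (P m r))
    (hL2 : L 2 = linkingForm l)
    (hLtree : ∀ m, 2 ≤ m → IsTreePolynomial m (L m)) :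
    ∃ (L' : ℕ → VecPoly (Fin n)) (P' : ℕ → ℕ → VecPoly (Fin n)),
      (∀ m, IsInvariantForm m (L' m)) ∧
      (∀ m r, IsInvariantForm m (P' m r)) ∧
      (∀ m, IsTreePolynomial m (L' m)) ∧
      L' 2 = linkingForm (reducedLinking l) ∧
      ∀ K : ℝ, 0 < K → ∀ a : Fin n → Fin 3 → ℝ,
        ∃ I : PowerSeries ℂ,
          HasFormalIntegralAt (stationaryPoint l a)
            (fun v => integrand L P K (Matrix.vecCons v a)) I ∧
          framingFactor (l 0 0) K *
              PowerSeries.C (((K / 2) ^ (3 / 2 : ℝ) : ℝ) : ℂ) * I =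
            formalExp (exponent L' P' K a) := by
  obtain ⟨P₁, hP₁, hint⟩ := exists_integrand_eq_formalExp L P hP
  set p₀ : ℂ := MvPolynomial.coeff 0 (P₁ 0 0)
  set V := shiftedExponent l L P₁
  have hV0 : V 0 = 0 := shiftedExponent_zero l L P₁
  have hV : ∀ k, V k ∈ expansionTerms _ 0 k := shiftedExponent_mem_expansionTerms l hLtree hP₁
  -- the time at which the flow computes the Gaussian integral over `a_1`
  set s : ℂ := Complex.I / (2 * Real.pi * (l 0 0 : ℝ))
  obtain ⟨T, Q, hT, hQ, hTQ⟩ := exists_map_flowSeries_eq hV s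
  let L' : ℕ → VecPoly (Fin n) := fun m =>
    if m < 2 then 0 else if m = 2 then linkingForm (reducedLinking l) else
      (2 / (Complex.I * Real.pi)) • T (m - 2)
  -- the additional constants come from `|l₁₁| ^ (-3/2)` and from the framing factor
  let P' : ℕ → ℕ → VecPoly (Fin n) := fun m r =>
    if m + 2 * r = 0 then MvPolynomial.C (p₀ - 3 / 2 * (Real.log |l 0 0| : ℝ)) else
      Q (m + 2 * r) r + if m = 0 ∧ r = 1 then
        MvPolynomial.C (3 / 2 * Complex.I * Real.pi * (Real.sign (l 0 0) : ℂ)) else 0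
  have hL'tree : ∀ m, IsTreePolynomial m (L' m) := fun m => by
    simp only [L']
    split_ifs with h1 h2
    · exact Submodule.zero_mem _
    · subst h2
      exact isTreePolynomial_linkingForm _
    · have := hT (m - 2)
      rw [Nat.sub_add_cancel (by omega)] at this
      exact Submodule.smul_mem _ _ this
  have hconst : ∀ c : ℂ, IsInvariantForm 0 (MvPolynomial.C c : VecPoly (Fin n)) := fun c =>
    ⟨MvPolynomial.isHomogeneous_C _ _, fun U _ a b _ => by simp [VecPoly.at]⟩
  refine ⟨L', P', fun m => (hL'tree m).isInvariantForm, fun m r => ?_, hL'tree, rfl, ?_⟩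
  · simp only [P']
    split_ifs with h1 h2
    · obtain rfl : m = 0 := by omega
      exact hconst _
    · obtain ⟨rfl, rfl⟩ := h2
      exact (invariantForms _ 0).add_mem (hQ _ 1 (by omega)) (hconst _)
    · rw [add_zero]
      have := hQ (m + 2 * r) r (by omega)
      rwa [Nat.add_sub_cancel] at this
  intro K hK a
  have hK' : (K : ℂ) ≠ 0 := by exact_mod_cast hK.ne'
  have h0 : ∀ σ b, PowerSeries.constantCoeff
      (PowerSeries.map (evalTime σ a b) (flowSeries 0 V K)) = 0 := fun σ b => by
    have h := constantCoeff_flowSeries (0 : Fin (n + 1)) hV0 (K : ℂ)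
    rw [← PowerSeries.coeff_zero_eq_constantCoeff_apply] at h ⊢
    rw [PowerSeries.coeff_map, h, map_zero]
  set y : ℂ := Complex.I * Real.pi * K / 2 * (linkingForm (reducedLinking l)).at a + p₀ with hy
  refine ⟨PowerSeries.C (Complex.exp y * ((Real.pi / (-(Complex.I *
    (Real.pi * K * l 0 0 / 2 : ℝ))) : ℂ) ^ (1 / 2 : ℂ)) ^ 3) * PowerSeries.expOf
      (PowerSeries.map (evalTime s a 0) (flowSeries 0 V K)), fun k => ?_, ?_⟩
  · rw [PowerSeries.coeff_C_mul]
    convert hasOscillatoryIntegral_expOf_flowSeries hV hV0 hK h11 a y k using 1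
    ext b
    change PowerSeries.coeff k (integrand L P K _) = _
    rw [hint, exponent_eq_add_map_flowSeries hl h11 hL2 hLtree hP₁ hK, formalExp_add,
      formalExp_C, PowerSeries.coeff_C_mul,
      formalExp_of_constantCoeff_eq_zero (h0 _ _)]
  · have hfr : framingFactor (l 0 0) K = PowerSeries.C
        (Complex.exp (-(3 / 4) * Complex.I * (Real.pi : ℂ) * (Real.sign (l 0 0) : ℂ))) *
        formalExp (PowerSeries.C (3 / 2 * Complex.I * (Real.pi : ℂ) * (Real.sign (l 0 0) : ℂ) *
          (K : ℂ)⁻¹) * PowerSeries.X ^ 2) := by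
      rw [framingFactor, formalExp_add, formalExp_C]
    have hpre := gaussian_prefactor h11 hK
    have htotal : exponent L' P' K a = PowerSeries.C (y + -(3 / 2) * (Real.log |l 0 0| : ℝ)) +
        (PowerSeries.C (3 / 2 * Complex.I * (Real.pi : ℂ) * (Real.sign (l 0 0) : ℂ) *
          (K : ℂ)⁻¹) * PowerSeries.X ^ 2 +
        PowerSeries.map (evalTime s a 0) (flowSeries 0 V K)) := by
      ext k
      rw [map_add (PowerSeries.coeff k), map_add (PowerSeries.coeff k), PowerSeries.coeff_C,
        PowerSeries.coeff_C_mul, PowerSeries.coeff_X_pow,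
        exponent, PowerSeries.coeff_mk]
      by_cases hk : k = 0
      · subst hk
        have := h0 s 0
        rw [← PowerSeries.coeff_zero_eq_constantCoeff_apply] at this
        rw [this]
        simp [L', P', hy, VecPoly.at]
        ring
      · rw [hTQ K hK, if_neg hk]
        have e1 : L' (k + 2) = (2 / (Complex.I * Real.pi)) • T k := by
          simp [L', hk]
        have e2 : ∀ r ∈ Finset.range (k / 2 + 1), (P' (k - 2 * r) r).at a * (K : ℂ)⁻¹ ^ r =
            (Q k r).at a * (K : ℂ)⁻¹ ^ r + if r = 1 then (if k = 2 then
              3 / 2 * Complex.I * Real.pi * (Real.sign (l 0 0) : ℂ) * (K : ℂ)⁻¹ else 0) else 0 := by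
          intro r hr
          have hr' := Finset.mem_range.1 hr
          have hkr : k - 2 * r + 2 * r = k := by omega
          simp only [P', hkr, if_neg hk]
          rw [← VecPoly.evalAt_apply, map_add, add_mul, VecPoly.evalAt_apply]
          congr 1
          by_cases hr1 : r = 1
          · subst hr1
            by_cases hk2 : k = 2
            · simp [hk2, VecPoly.evalAt]
            · have : ¬ k ≤ 2 := by omega
              simp [hk2, this, Nat.sub_eq_zero_iff_le]
          · simp [hr1]
        have e3 : ∑ r ∈ Finset.range (k / 2 + 1), (if r = 1 then (if k = 2 then
              3 / 2 * Complex.I * Real.pi * (Real.sign (l 0 0) : ℂ) * (K : ℂ)⁻¹ else 0) else 0) =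
            3 / 2 * Complex.I * Real.pi * (Real.sign (l 0 0) : ℂ) * (K : ℂ)⁻¹ *
              if k = 2 then 1 else 0 := by
          by_cases hk2 : k = 2
          · subst hk2; simp
          · simp [hk2]
        rw [Finset.sum_congr rfl e2, Finset.sum_add_distrib, e3, e1, ← VecPoly.evalAt_apply,
          map_smul, VecPoly.evalAt_apply, smul_eq_mul]
        have hI := Complex.I_ne_zero
        field_simp
        ring
    rw [htotal, formalExp_add, formalExp_add, formalExp_C, Complex.exp_add y, ← hpre, hfr,
      formalExp_of_constantCoeff_eq_zero (h0 s 0)]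
    simp only [map_mul]
    ring
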